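/- Let $r,s\in\mathbb C^*$ be roots of unity with $r^2\neq s^2$. Let $U=U^+_{r,s}(B_2)$ be the unital associative $\mathbb C$-algebra generated by $e_1,e_2$ with relations $$e_1^2e_2-(r^2+s^2)e_1e_2e_1+r^2s^2e_2e_1^2=0,$$ $$e_1e_2^3-(r^2+rs+s^2)e_2e_1e_2^2+rs(r^2+rs+s^2)e_2^2e_1e_2-r^3s^3e_2^3e_1=0,$$ and put $X_1=e_1$, $X_2=e_1e_2-r^2e_2e_1$, $X_3=e_2X_2-s^{-2}X_2e_2$, $X_4=e_2$. Modules are right modules, and $\operatorname{ord}$ denotes multiplicative order. **The modules $M(\nu)$.** For $\nu=(\nu_1,\nu_2,\nu_3)\in(\mathbb C^*)^2\times\mathbb C$ let $\ell_3=\operatorname{ord}(rs)$; let $m_3=\operatorname{ord}(r^{-2}s^2)$ if $\operatorname{ord}(s^2)\mid\operatorname{ord}(r^{-2}s^2)\operatorname{ord}(rs)$ or $\nu_3=0$, and $m_3=2\operatorname{ord}(r^{-2}s^2)$ otherwise. $M(\nu)$ has basis $e(a,b)$, $0\le a\le \ell_3-1$, $0\le b\le m_3-1$, and ($\oplus$ being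 addition modulo $\ell_3$) $$e(a,b)X_1=-s^{-4(b-1)}(rs)^{-2}(1-r^{-1}s)\frac{1-(r^{-1}s)^{2b}}{1-(r^{-1}s)^2}\,\nu_1^2\,e(a\oplus2,b-1)\ (b\ne0),\qquad e(a,0)X_1=0,$$ $$e(a,b)X_2=s^{-2b}\nu_1e(a\oplus1,b),\qquad e(a,b)X_3=(rs)^a\nu_2e(a,b),$$ $$e(a,b)X_4=\frac{s^{2b}}{s^{-2}-r^{-1}s^{-1}}\Big[\nu_1^{-1}e(a\oplus(-1),b+1)-(rs)^{a-1}\nu_1^{-1}\nu_2e(a\oplus(-1),b)\Big]\quad(b\ne m_3-1),$$ $$e(a,b)X_4=\frac{s^{2b}}{s^{-2}-r^{-1}s^{-1}}\Big[s^{2(a-1)m_3}\nu_1^{-1}\nu_3e(a\oplus(-1),0)-(rs)^{a-1}\nu_1^{-1}\nu_2e(a\oplus(-1),b)\Big]\quad(b= m_3-1).$$ **The modules $M(\xi)$.** For $\xi=(\xi_1,\xi_2)\in\mathbb C^*\times\mathbb C$ let $\ell_4=\operatorname{lcm}(\operatorname{ord}(rs),\operatorname{ord}(rs^{-1}))$ if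 $\xi_2\neq0$ and $\ell_4=\operatorname{ord}(rs^{-1})$ if $\xi_2=0$. $M(\xi)$ has basis $e(a)$, $0\le a\le\ell_4-1$, and $$e(a)X_1=-r^{-2(a-1)}\frac{1-(rs^{-1})^{a-1}}{1-rs^{-1}}\,\frac{1-(rs^{-1})^a}{1-(rs^{-1})^2}\,\xi_1e(a-2)\ (a\ne0,1),\qquad e(0)X_1=e(1)X_1=0,$$ $$e(a)X_2=(rs)^{-(a-1)}\frac{1-(rs^{-1})^a}{1-rs^{-1}}\,\xi_1e(a-1)\ (a\neq0),\qquad e(0)X_2=0,\qquad e(a)X_3=(rs)^{-a}\xi_1e(a),$$ $$e(a)X_4=e(a+1)\ (a\ne\ell_4-1),\qquad e(\ell_4-1)X_4=\xi_2e(0).$$ **Theorem.** Let $l$ be any positive integer with $(rs)^l=(rs^{-1})^l=1$, for instance $l=\operatorname{lcm}(\operatorname{ord}(rs),\operatorname{ord}(rs^{-1}))$. Then $X_2^l$ is central in $U$. Let $N$ be a simple right $U$-module on which $X_1$ acts nilpotently and $X_3$ acts invertibly. Then $X_2^l$ acts on $N$ as a scalar $\beta\in\mathbb C$, and 1. (Case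 I) if $\beta\neq0$, then $N\cong M(\nu)$ as $U$-modules for some $\nu\in(\mathbb C^*)^2\times\mathbb C$; 2. (Case II) if $\beta=0$, then $N\cong M(\xi)$ as $U$-modules for some $\xi\in\mathbb C^*\times\mathbb C$. -/

import Mathlib

namespace UB2

/-! ### The algebra -/

/-- The two defining Serre-type relations on the free algebra in `e₁ = ι 0`, `e₂ = ι 1`. -/
inductive Rel (r s : ℂ) : FreeAlgebra ℂ (Fin 2) → FreeAlgebra ℂ (Fin 2) → Prop
  | serre₁ (e₁ e₂ : FreeAlgebra ℂ (Fin 2))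
      (h₁ : e₁ = FreeAlgebra.ι ℂ 0) (h₂ : e₂ = FreeAlgebra.ι ℂ 1) :
      Rel r s (e₁ ^ 2 * e₂ - (r ^ 2 + s ^ 2) • (e₁ * e₂ * e₁) + (r ^ 2 * s ^ 2) • (e₂ * e₁ ^ 2)) 0
  | serre₂ (e₁ e₂ : FreeAlgebra ℂ (Fin 2))
      (h₁ : e₁ = FreeAlgebra.ι ℂ 0) (h₂ : e₂ = FreeAlgebra.ι ℂ 1) :
      Rel r s (e₁ * e₂ ^ 3 - (r ^ 2 + r * s + s ^ 2) • (e₂ * e₁ * e₂ ^ 2)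
        + (r * s * (r ^ 2 + r * s + s ^ 2)) • (e₂ ^ 2 * e₁ * e₂)
        - (r ^ 3 * s ^ 3) • (e₂ ^ 3 * e₁)) 0

/-- The two-parameter quantized enveloping algebra `U⁺_{r,s}(B₂)`. -/
def UPlus (r s : ℂ) : Type := RingQuot (Rel r s)

noncomputable instance (r s : ℂ) : Ring (UPlus r s) := inferInstanceAs (Ring (RingQuot (Rel r s)))

noncomputable instance (r s : ℂ) : Algebra ℂ (UPlus r s) :=
  inferInstanceAs (Algebra ℂ (RingQuot (Rel r s)))

noncomputable def e₁ (r s : ℂ) : UPlus r s := RingQuot.mkAlgHom ℂ (Rel r s) (FreeAlgebra.ι ℂ 0)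

noncomputable def e₂ (r s : ℂ) : UPlus r s := RingQuot.mkAlgHom ℂ (Rel r s) (FreeAlgebra.ι ℂ 1)

noncomputable def X₁ (r s : ℂ) : UPlus r s := e₁ r s

noncomputable def X₂ (r s : ℂ) : UPlus r s := e₁ r s * e₂ r s - r ^ 2 • (e₂ r s * e₁ r s)

noncomputable def X₃ (r s : ℂ) : UPlus r s :=
  e₂ r s * X₂ r s - (s ^ 2)⁻¹ • (X₂ r s * e₂ r s)

noncomputable def X₄ (r s : ℂ) : UPlus r s := e₂ r s

/-- Standing assumptions on the parameters: `r`, `s` are roots of unity with `r² ≠ s²`. -/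
structure Params (r s : ℂ) : Prop where
  finite_r : IsOfFinOrder r
  finite_s : IsOfFinOrder s
  sq_ne : r ^ 2 ≠ s ^ 2

theorem Params.r_ne {r s : ℂ} (h : Params r s) : r ≠ 0 := h.finite_r.isUnit.ne_zero

theorem Params.s_ne {r s : ℂ} (h : Params r s) : s ≠ 0 := h.finite_s.isUnit.ne_zero

theorem Params.ord_rs_pos {r s : ℂ} (h : Params r s) : 0 < orderOf (r * s) :=
  (h.finite_r.mul h.finite_s).orderOf_pos

theorem isOfFinOrder_inv {x : ℂ} (hx : IsOfFinOrder x) : IsOfFinOrder x⁻¹ := by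
  obtain ⟨n, hn, h⟩ := isOfFinOrder_iff_pow_eq_one.1 hx
  exact isOfFinOrder_iff_pow_eq_one.2 ⟨n, hn, by rw [inv_pow, h, inv_one]⟩

theorem Params.ord_q_pos {r s : ℂ} (h : Params r s) : 0 < orderOf ((r ^ 2)⁻¹ * s ^ 2) :=
  ((isOfFinOrder_inv (h.finite_r.pow)).mul (h.finite_s.pow)).orderOf_pos

theorem Params.ord_p_pos {r s : ℂ} (h : Params r s) : 0 < orderOf (r * s⁻¹) :=
  (h.finite_r.mul (isOfFinOrder_inv h.finite_s)).orderOf_pos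

theorem Params.sub_ne {r s : ℂ} (h : Params r s) : r - s ≠ 0 := fun e =>
  h.sq_ne (by rw [sub_eq_zero.1 e])

theorem Params.add_ne {r s : ℂ} (h : Params r s) : r + s ≠ 0 := fun e =>
  h.sq_ne (by rw [eq_neg_of_add_eq_zero_left e]; ring)

/-! ### Right modules from operators

A right module over `U` is a module over the opposite ring `Uᵐᵒᵖ`: the product `v · x` is
`MulOpposite.op x • v`. -/

section Ops

variable {V : Type*} [AddCommGroup V] [Module ℂ V]

/-- Four operators `A i : v ↦ v · Xᵢ` that are compatible with the defining relations of the `Xᵢ`.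
Since the operators act on the right, `v · (X Y) = Y (X v)`. -/
structure IsAction (r s : ℂ) (A₁ A₂ A₃ A₄ : Module.End ℂ V) : Prop where
  r12 : ∀ v, A₂ (A₁ v) = s ^ 2 • A₁ (A₂ v)
  r14 : ∀ v, A₄ (A₁ v) = r ^ 2 • A₁ (A₄ v) + A₂ v
  r24 : ∀ v, A₄ (A₂ v) = s ^ 2 • A₂ (A₄ v) - s ^ 2 • A₃ v
  r34 : ∀ v, A₄ (A₃ v) = (r * s) • A₃ (A₄ v)

theorem IsAction.serre₁ {r s : ℂ} {A₁ A₂ A₃ A₄ : Module.End ℂ V}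
    (h : IsAction r s A₁ A₂ A₃ A₄) (v : V) :
    A₄ (A₁ (A₁ v)) - (r ^ 2 + s ^ 2) • A₁ (A₄ (A₁ v)) + (r ^ 2 * s ^ 2) • A₁ (A₁ (A₄ v)) = 0 := by
  have e : ∀ v, A₂ v = A₄ (A₁ v) - r ^ 2 • A₁ (A₄ v) := fun v => by rw [h.r14]; abel
  have := h.r12 v
  simp only [e, map_sub, map_smul] at this
  rw [← sub_eq_zero] at this
  rw [← this]
  module

theorem IsAction.serre₂ {r s : ℂ} {A₁ A₂ A₃ A₄ : Module.End ℂ V}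
    (h : IsAction r s A₁ A₂ A₃ A₄) (v : V) :
    A₄ (A₄ (A₄ (A₁ v))) - (r ^ 2 + r * s + s ^ 2) • A₄ (A₄ (A₁ (A₄ v)))
      + (r * s * (r ^ 2 + r * s + s ^ 2)) • A₄ (A₁ (A₄ (A₄ v)))
      - (r ^ 3 * s ^ 3) • A₁ (A₄ (A₄ (A₄ v))) = 0 := by
  have e : ∀ v, A₂ v = A₄ (A₁ v) - r ^ 2 • A₁ (A₄ v) := fun v => by rw [h.r14]; abel
  have e3 : ∀ v, s ^ 2 • A₃ v = s ^ 2 • A₂ (A₄ v) - A₄ (A₂ v) := fun v => by rw [h.r24]; abel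
  have h34 : A₄ (s ^ 2 • A₃ v) = (r * s) • (s ^ 2 • A₃ (A₄ v)) := by
    rw [map_smul, h.r34, smul_comm]
  rw [e3, e3] at h34
  simp only [e, map_sub, map_smul] at h34
  rw [← sub_eq_zero] at h34
  rw [← neg_eq_zero, ← h34]
  module

/-- The algebra map `x ↦ (v ↦ v · x)` determined by `e₁ ↦ A₁`, `e₂ ↦ A₄`. -/
noncomputable def IsAction.hom {r s : ℂ} {A₁ A₂ A₃ A₄ : Module.End ℂ V}
    (h : IsAction r s A₁ A₂ A₃ A₄) : UPlus r s →ₐ[ℂ] (Module.End ℂ V)ᵐᵒᵖ :=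
  RingQuot.liftAlgHom ℂ ⟨FreeAlgebra.lift ℂ ![MulOpposite.op A₁, MulOpposite.op A₄], by
    intro x y hxy
    cases hxy with
    | serre₁ a b ha hb =>
      subst ha hb
      apply MulOpposite.unop_injective
      ext v
      simpa [pow_succ, mul_assoc] using h.serre₁ v
    | serre₂ a b ha hb =>
      subst ha hb
      apply MulOpposite.unop_injective
      ext v
      simpa [pow_succ, mul_assoc] using h.serre₂ v⟩

theorem IsAction.hom_X₁ {r s : ℂ} {A₁ A₂ A₃ A₄ : Module.End ℂ V}
    (h : IsAction r s A₁ A₂ A₃ A₄) : h.hom (X₁ r s) = MulOpposite.op A₁ := by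
  refine (RingQuot.liftAlgHom_mkAlgHom_apply ℂ _ _ _).trans ?_
  simp

theorem IsAction.hom_X₄ {r s : ℂ} {A₁ A₂ A₃ A₄ : Module.End ℂ V}
    (h : IsAction r s A₁ A₂ A₃ A₄) : h.hom (X₄ r s) = MulOpposite.op A₄ := by
  refine (RingQuot.liftAlgHom_mkAlgHom_apply ℂ _ _ _).trans ?_
  simp

theorem IsAction.hom_X₂ {r s : ℂ} {A₁ A₂ A₃ A₄ : Module.End ℂ V}
    (h : IsAction r s A₁ A₂ A₃ A₄) : h.hom (X₂ r s) = MulOpposite.op A₂ := by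
  have : X₂ r s = X₁ r s * X₄ r s - r ^ 2 • (X₄ r s * X₁ r s) := rfl
  rw [this, map_sub, map_smul, map_mul, map_mul, h.hom_X₁, h.hom_X₄]
  apply MulOpposite.unop_injective
  ext v
  simp [h.r14]

theorem IsAction.hom_X₃ {r s : ℂ} (hs : s ≠ 0) {A₁ A₂ A₃ A₄ : Module.End ℂ V}
    (h : IsAction r s A₁ A₂ A₃ A₄) : h.hom (X₃ r s) = MulOpposite.op A₃ := by
  have : X₃ r s = X₄ r s * X₂ r s - (s ^ 2)⁻¹ • (X₂ r s * X₄ r s) := rfl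
  rw [this, map_sub, map_smul, map_mul, map_mul, h.hom_X₂, h.hom_X₄]
  apply MulOpposite.unop_injective
  ext v
  have hs2 : s ^ 2 ≠ 0 := pow_ne_zero 2 hs
  simp [h.r24, smul_sub, smul_smul, inv_mul_cancel₀ hs2]

/-- The right `U⁺_{r,s}(B₂)`-module structure given by the operators. -/
noncomputable abbrev IsAction.module {r s : ℂ} {A₁ A₂ A₃ A₄ : Module.End ℂ V}
    (h : IsAction r s A₁ A₂ A₃ A₄) : Module (UPlus r s)ᵐᵒᵖ V :=
  Module.compHom V (AlgHom.opComm (h.hom) : (UPlus r s)ᵐᵒᵖ →ₐ[ℂ] Module.End ℂ V).toRingHom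

end Ops

/-! ### The modules `M(ν)` -/

/-- `ℓ₃ = ord(rs)`. -/
noncomputable def ell₃ (r s : ℂ) : ℕ := orderOf (r * s)

open Classical in
/-- `m₃ = ord(r⁻²s²)` if `ord(s²) ∣ ord(r⁻²s²) ord(rs)` or `ν₃ = 0`, else `2 ord(r⁻²s²)`. -/
noncomputable def m₃ (r s ν₃ : ℂ) : ℕ :=
  if orderOf (s ^ 2) ∣ orderOf ((r ^ 2)⁻¹ * s ^ 2) * orderOf (r * s) ∨ ν₃ = 0 then
    orderOf ((r ^ 2)⁻¹ * s ^ 2)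
  else 2 * orderOf ((r ^ 2)⁻¹ * s ^ 2)

/-- The vector space with basis `e(a, b)`, `a` modulo `ℓ₃`, `0 ≤ b < m₃`. -/
abbrev VNu (r s ν₃ : ℂ) : Type := ZMod (ell₃ r s) × Fin (m₃ r s ν₃) →₀ ℂ

/-- The basis vector `e(a, b)` (with `e(a, b) = 0` for `b` out of range, which is never used). -/
noncomputable def eNu (r s ν₃ : ℂ) (a : ZMod (ell₃ r s)) (b : ℕ) : VNu r s ν₃ :=
  if hb : b < m₃ r s ν₃ then Finsupp.single (a, ⟨b, hb⟩) 1 else 0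

noncomputable def nuX₁ (r s : ℂ) (ν₁ : ℂˣ) (ν₃ : ℂ) : Module.End ℂ (VNu r s ν₃) :=
  Finsupp.linearCombination ℂ fun p : ZMod (ell₃ r s) × Fin (m₃ r s ν₃) =>
    if (p.2 : ℕ) = 0 then 0 else
      (-(s ^ (-4 * ((p.2 : ℤ) - 1)) * (r * s) ^ (-2 : ℤ) * (1 - r⁻¹ * s)
        * ((1 - (r⁻¹ * s) ^ (2 * (p.2 : ℕ))) / (1 - (r⁻¹ * s) ^ 2)) * (ν₁ : ℂ) ^ 2))
        • eNu r s ν₃ (p.1 + 2) (p.2 - 1)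

noncomputable def nuX₂ (r s : ℂ) (ν₁ : ℂˣ) (ν₃ : ℂ) : Module.End ℂ (VNu r s ν₃) :=
  Finsupp.linearCombination ℂ fun p : ZMod (ell₃ r s) × Fin (m₃ r s ν₃) =>
    (s ^ (-2 * (p.2 : ℤ)) * (ν₁ : ℂ)) • eNu r s ν₃ (p.1 + 1) p.2

noncomputable def nuX₃ (r s : ℂ) (ν₂ : ℂˣ) (ν₃ : ℂ) : Module.End ℂ (VNu r s ν₃) :=
  Finsupp.linearCombination ℂ fun p : ZMod (ell₃ r s) × Fin (m₃ r s ν₃) =>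
    ((r * s) ^ p.1.val * (ν₂ : ℂ)) • eNu r s ν₃ p.1 p.2

noncomputable def nuX₄ (r s : ℂ) (ν₁ ν₂ : ℂˣ) (ν₃ : ℂ) : Module.End ℂ (VNu r s ν₃) :=
  Finsupp.linearCombination ℂ fun p : ZMod (ell₃ r s) × Fin (m₃ r s ν₃) =>
    (s ^ (2 * (p.2 : ℕ)) / (s ^ (-2 : ℤ) - r⁻¹ * s⁻¹)) •
      ((if (p.2 : ℕ) = m₃ r s ν₃ - 1 then
          (s ^ (2 * ((p.1.val : ℤ) - 1) * (m₃ r s ν₃ : ℤ)) * (ν₁ : ℂ)⁻¹ * ν₃)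
            • eNu r s ν₃ (p.1 - 1) 0
        else (ν₁ : ℂ)⁻¹ • eNu r s ν₃ (p.1 - 1) (p.2 + 1))
      - ((r * s) ^ ((p.1.val : ℤ) - 1) * (ν₁ : ℂ)⁻¹ * (ν₂ : ℂ)) • eNu r s ν₃ (p.1 - 1) p.2)

theorem q_pow_m₃ (r s ν₃ : ℂ) : (r⁻¹ * s) ^ (2 * m₃ r s ν₃) = 1 := by
  have hq : (r⁻¹ * s) ^ 2 = (r ^ 2)⁻¹ * s ^ 2 := by rw [mul_pow, inv_pow]
  rw [pow_mul, hq]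
  unfold m₃
  split_ifs
  · exact pow_orderOf_eq_one _
  · rw [mul_comm 2, pow_mul, pow_orderOf_eq_one, one_pow]

theorem s_pow_m₃ {r s : ℂ} (h : Params r s) (ν₃ : ℂ) :
    s ^ (2 * ell₃ r s * m₃ r s ν₃) * ν₃ = ν₃ := by
  have hr := h.r_ne
  by_cases h0 : ν₃ = 0
  · simp [h0]
  suffices s ^ (2 * ell₃ r s * m₃ r s ν₃) = 1 by rw [this, one_mul]
  unfold m₃ ell₃
  split_ifs with hc
  · obtain ⟨k, hk⟩ := hc.resolve_right h0
    rw [mul_assoc, pow_mul, mul_comm (orderOf (r * s)), hk, pow_mul, pow_orderOf_eq_one, one_pow]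
  · have e : s ^ (2 * orderOf (r * s) * (2 * orderOf ((r ^ 2)⁻¹ * s ^ 2)))
        = ((r * s) ^ orderOf (r * s)) ^ (2 * orderOf ((r ^ 2)⁻¹ * s ^ 2))
          * (((r ^ 2)⁻¹ * s ^ 2) ^ orderOf ((r ^ 2)⁻¹ * s ^ 2)) ^ orderOf (r * s) := by
      generalize orderOf (r * s) = x
      generalize orderOf ((r ^ 2)⁻¹ * s ^ 2) = y
      rw [← pow_mul, ← pow_mul, mul_comm y x,
        show x * (2 * y) = 2 * (x * y) by ring, show 2 * x * (2 * y) = 4 * (x * y) by ring,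
        pow_mul, pow_mul _ 2, ← mul_pow]
      congr 1
      field_simp
    rw [e, pow_orderOf_eq_one, pow_orderOf_eq_one, one_pow, one_pow, one_mul]

theorem m₃_pos {r s : ℂ} (h : Params r s) (ν₃ : ℂ) : 0 < m₃ r s ν₃ := by
  have := h.ord_q_pos
  unfold m₃
  split_ifs <;> omega

theorem zmod_pow {n : ℕ} [NeZero n] {x c : ℂ} (hx : x ≠ 0) (hc : x ^ n * c = c) (a : ZMod n)
    (k : ℤ) (hk : (k : ZMod n) = a) : x ^ k * c = x ^ a.val * c := by
  have h1 : ∀ j : ℤ, (x ^ n) ^ j * c = c := by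
    by_cases h0 : c = 0
    · simp [h0]
    · have : x ^ n = 1 := by simpa [h0] using hc
      simp [this]
  have h2 : ((k : ℤ) : ZMod n) = ((a.val : ℤ) : ZMod n) := by simp [hk]
  obtain ⟨j, hj⟩ := (ZMod.intCast_eq_intCast_iff_dvd_sub _ _ n).1 h2.symm
  have h3 : k = (n : ℤ) * j + (a.val : ℤ) := by omega
  rw [h3, zpow_add₀ hx, zpow_mul, zpow_natCast, zpow_natCast, mul_right_comm, h1, mul_comm]

theorem ext_nu {r s ν₃ : ℂ} {W : Type*} [AddCommGroup W] [Module ℂ W] {f g : VNu r s ν₃ →ₗ[ℂ] W}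
    (h : ∀ a b, b < m₃ r s ν₃ → f (eNu r s ν₃ a b) = g (eNu r s ν₃ a b)) : f = g := by
  refine Finsupp.lhom_ext' fun p => LinearMap.ext_ring ?_
  have := h p.1 p.2 p.2.2
  simpa [eNu] using this

theorem nuX₁_zero (r s : ℂ) (ν₁ : ℂˣ) (ν₃ : ℂ) (a : ZMod (ell₃ r s)) :
    nuX₁ r s ν₁ ν₃ (eNu r s ν₃ a 0) = 0 := by
  unfold nuX₁
  rw [eNu]
  split_ifs <;> simp

theorem nuX₁_succ (r s : ℂ) (ν₁ : ℂˣ) (ν₃ : ℂ) (a : ZMod (ell₃ r s)) {b : ℕ}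
    (hb : b + 1 < m₃ r s ν₃) :
    nuX₁ r s ν₁ ν₃ (eNu r s ν₃ a (b + 1)) =
      (-(((s ^ 4) ^ b)⁻¹ * ((r * s) ^ 2)⁻¹ * (1 - r⁻¹ * s)
        * ((1 - (r⁻¹ * s) ^ (2 * (b + 1))) / (1 - (r⁻¹ * s) ^ 2)) * (ν₁ : ℂ) ^ 2))
        • eNu r s ν₃ (a + 2) b := by
  have e : s ^ (-4 * (((b + 1 : ℕ) : ℤ) - 1)) = ((s ^ 4) ^ b)⁻¹ := by
    rw [← pow_mul, ← zpow_natCast, ← zpow_neg]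
    congr 1
    push_cast
    ring
  have e' : (r * s) ^ (-2 : ℤ) = ((r * s) ^ 2)⁻¹ := by
    rw [zpow_neg]; norm_cast
  unfold nuX₁
  rw [eNu, dif_pos hb, Finsupp.linearCombination_single, one_smul]
  simp only [e, e', Nat.add_sub_cancel, Nat.succ_ne_zero, if_false]

theorem nuX₂_apply (r s : ℂ) (ν₁ : ℂˣ) (ν₃ : ℂ) (a : ZMod (ell₃ r s)) {b : ℕ}
    (hb : b < m₃ r s ν₃) :
    nuX₂ r s ν₁ ν₃ (eNu r s ν₃ a b) = (((s ^ 2) ^ b)⁻¹ * (ν₁ : ℂ)) • eNu r s ν₃ (a + 1) b := by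
  have e : s ^ (-2 * (b : ℤ)) = ((s ^ 2) ^ b)⁻¹ := by
    rw [← pow_mul, ← zpow_natCast, ← zpow_neg]
    congr 1
  unfold nuX₂
  rw [eNu, dif_pos hb, Finsupp.linearCombination_single, one_smul]
  simp only [e]

theorem nuX₃_apply (r s : ℂ) (ν₂ : ℂˣ) (ν₃ : ℂ) (a : ZMod (ell₃ r s)) {b : ℕ}
    (hb : b < m₃ r s ν₃) :
    nuX₃ r s ν₂ ν₃ (eNu r s ν₃ a b) = ((r * s) ^ a.val * (ν₂ : ℂ)) • eNu r s ν₃ a b := by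
  unfold nuX₃
  rw [eNu, dif_pos hb, Finsupp.linearCombination_single, one_smul]
  simp only [eNu, dif_pos hb]

/-- `e(a, b)` for `b < m₃`, continued by `e(a, m₃) = s^{2 a m₃} ν₃ e(a, 0)`. -/
noncomputable def eNu' (r s ν₃ : ℂ) (a : ZMod (ell₃ r s)) (b : ℕ) : VNu r s ν₃ :=
  if b = m₃ r s ν₃ then ((s ^ (2 * m₃ r s ν₃)) ^ a.val * ν₃) • eNu r s ν₃ a 0 else eNu r s ν₃ a b

theorem zmod_pow_rs {r s : ℂ} (h : Params r s) (a : ZMod (ell₃ r s)) (k : ℤ)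
    (hk : (k : ZMod (ell₃ r s)) = a) : (r * s) ^ k = (r * s) ^ a.val := by
  have : NeZero (ell₃ r s) := ⟨h.ord_rs_pos.ne'⟩
  have := zmod_pow (c := 1) (mul_ne_zero h.r_ne h.s_ne)
    (by rw [mul_one]; exact pow_orderOf_eq_one (r * s)) a k hk
  simpa using this

theorem zmod_pow_s {r s : ℂ} (h : Params r s) (ν₃ : ℂ) (a : ZMod (ell₃ r s)) (k : ℤ)
    (hk : (k : ZMod (ell₃ r s)) = a) :
    (s ^ (2 * m₃ r s ν₃)) ^ k * ν₃ = (s ^ (2 * m₃ r s ν₃)) ^ a.val * ν₃ := by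
  have : NeZero (ell₃ r s) := ⟨h.ord_rs_pos.ne'⟩
  refine zmod_pow (pow_ne_zero _ h.s_ne) ?_ a k hk
  rw [← pow_mul]
  convert s_pow_m₃ h ν₃ using 3
  ring

theorem nuX₄_apply {r s : ℂ} (h : Params r s) (ν₁ ν₂ : ℂˣ) (ν₃ : ℂ) (a : ZMod (ell₃ r s)) {b : ℕ}
    (hb : b < m₃ r s ν₃) :
    nuX₄ r s ν₁ ν₂ ν₃ (eNu r s ν₃ a b) = ((s ^ 2) ^ b / ((s ^ 2)⁻¹ - r⁻¹ * s⁻¹)) •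
      ((ν₁ : ℂ)⁻¹ • eNu' r s ν₃ (a - 1) (b + 1)
        - ((r * s) ^ (a - 1).val * (ν₁ : ℂ)⁻¹ * (ν₂ : ℂ)) • eNu r s ν₃ (a - 1) b) := by
  have : NeZero (ell₃ r s) := ⟨h.ord_rs_pos.ne'⟩
  have hk : (((a.val : ℤ) - 1 : ℤ) : ZMod (ell₃ r s)) = a - 1 := by simp
  have e1 := zmod_pow_rs h _ _ hk
  have e2 := zmod_pow_s h ν₃ _ _ hk
  have e : s ^ (-2 : ℤ) = (s ^ 2)⁻¹ := by
    rw [zpow_neg]; norm_cast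
  have e3 : s ^ (2 * ((a.val : ℤ) - 1) * (m₃ r s ν₃ : ℤ))
      = (s ^ (2 * m₃ r s ν₃)) ^ ((a.val : ℤ) - 1) := by
    rw [← zpow_natCast s, ← zpow_mul]
    congr 1
    push_cast
    ring
  unfold nuX₄
  rw [eNu, dif_pos hb, Finsupp.linearCombination_single, one_smul]
  simp only [e, e1, pow_mul s 2 b, e3]
  congr 2
  unfold eNu'
  by_cases hc : b = m₃ r s ν₃ - 1
  · rw [if_pos hc, if_pos (by omega), smul_smul, mul_right_comm, e2]
    congr 1
    ring
  · rw [if_neg hc, if_neg (by omega)]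

theorem nu_isAction {r s : ℂ} (h : Params r s) (ν₁ ν₂ : ℂˣ) (ν₃ : ℂ) :
    IsAction r s (nuX₁ r s ν₁ ν₃) (nuX₂ r s ν₁ ν₃) (nuX₃ r s ν₂ ν₃) (nuX₄ r s ν₁ ν₂ ν₃) := by
  have hr := h.r_ne
  have hs := h.s_ne
  have hn := ν₁.ne_zero
  have hsub := h.sub_ne
  have hadd := h.add_ne
  have hD : (s ^ 2)⁻¹ - r⁻¹ * s⁻¹ = (r - s) / (r * s ^ 2) := by field_simp
  have hE : (1 - r⁻¹ * s) = (r - s) / r := by field_simp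
  have hF : (1 - (r⁻¹ * s) ^ 2) = (r - s) * (r + s) / r ^ 2 := by field_simp; ring
  have : NeZero (ell₃ r s) := ⟨h.ord_rs_pos.ne'⟩
  have hm := m₃_pos h ν₃
  have hval : ∀ a : ZMod (ell₃ r s), (r * s) ^ (a + 1).val = (r * s) ^ a.val * (r * s) := by
    intro a
    rw [← pow_succ, ← zpow_natCast _ (a.val + 1)]
    exact (zmod_pow_rs h _ _ (by simp)).symm
  have hval' : ∀ a : ZMod (ell₃ r s), (r * s) ^ a.val = (r * s) ^ (a - 1).val * (r * s) := by
    intro a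
    rw [← hval, sub_add_cancel]
  have hvs : ∀ a : ZMod (ell₃ r s), (s ^ (2 * m₃ r s ν₃)) ^ a.val * ν₃
      = (s ^ (2 * m₃ r s ν₃)) ^ (a - 1).val * ν₃ * s ^ (2 * m₃ r s ν₃) := by
    intro a
    rw [mul_right_comm, ← pow_succ, ← zpow_natCast _ ((a - 1).val + 1)]
    exact (zmod_pow_s h ν₃ _ _ (by simp)).symm
  -- the action of X₁ and X₂ on the continued basis
  have x2 : ∀ a b, b ≤ m₃ r s ν₃ → nuX₂ r s ν₁ ν₃ (eNu' r s ν₃ a b)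
      = (((s ^ 2) ^ b)⁻¹ * (ν₁ : ℂ)) • eNu' r s ν₃ (a + 1) b := by
    intro a b hb
    unfold eNu'
    split_ifs with hc
    · have := hvs (a + 1)
      rw [add_sub_cancel_right] at this
      rw [map_smul, nuX₂_apply _ _ _ _ _ hm, this, hc, pow_zero, smul_smul, smul_smul]
      congr 1
      have : s ^ (2 * m₃ r s ν₃) ≠ 0 := pow_ne_zero _ hs
      have hh : (s ^ 2) ^ m₃ r s ν₃ = s ^ (2 * m₃ r s ν₃) := (pow_mul _ _ _).symm
      rw [hh]
      field_simp
    · exact nuX₂_apply _ _ _ _ _ (by omega)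
  have x1 : ∀ a b, b < m₃ r s ν₃ → nuX₁ r s ν₁ ν₃ (eNu' r s ν₃ a (b + 1)) =
      (-(((s ^ 4) ^ b)⁻¹ * ((r * s) ^ 2)⁻¹ * (1 - r⁻¹ * s)
        * ((1 - (r⁻¹ * s) ^ (2 * (b + 1))) / (1 - (r⁻¹ * s) ^ 2)) * (ν₁ : ℂ) ^ 2))
        • eNu r s ν₃ (a + 2) b := by
    intro a b hb
    unfold eNu'
    split_ifs with hc
    · rw [map_smul, nuX₁_zero, hc, q_pow_m₃]
      simp
    · exact nuX₁_succ _ _ _ _ _ (by omega)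
  have ee : ∀ a b, b < m₃ r s ν₃ → eNu' r s ν₃ a b = eNu r s ν₃ a b := fun a b hb => by
    rw [eNu', if_neg hb.ne]
  have i1 : ∀ a : ZMod (ell₃ r s), a - 1 + 2 = a + 1 := fun a => by ring
  have i2 : ∀ a : ZMod (ell₃ r s), a + 2 - 1 = a + 1 := fun a => by ring
  have i3 : ∀ a : ZMod (ell₃ r s), a + 1 + 2 = a + 2 + 1 := fun a => by ring
  have hqq : ∀ b, (r⁻¹ * s) ^ (2 * b) = (s ^ 2) ^ b / (r ^ 2) ^ b := fun b => by
    rw [pow_mul, ← div_pow]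
    congr 1
    field_simp
  have h4 : ∀ b, (s ^ 4) ^ b = ((s ^ 2) ^ b) ^ 2 := fun b => by ring
  refine ⟨?_, ?_, ?_, ?_⟩
  · refine LinearMap.congr_fun (f := nuX₂ r s ν₁ ν₃ ∘ₗ nuX₁ r s ν₁ ν₃)
      (g := s ^ 2 • (nuX₁ r s ν₁ ν₃ ∘ₗ nuX₂ r s ν₁ ν₃)) (ext_nu fun a b hb => ?_)
    simp only [LinearMap.comp_apply, LinearMap.smul_apply]
    rw [nuX₂_apply _ _ _ _ _ hb, map_smul]
    rcases b with _ | b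
    · simp [nuX₁_zero]
    · rw [nuX₁_succ _ _ _ _ _ hb, nuX₁_succ _ _ _ _ _ hb, map_smul,
        nuX₂_apply _ _ _ _ _ (by omega), smul_smul, smul_smul, smul_smul, i3]
      congr 1
      field_simp
      ring
  · refine LinearMap.congr_fun (f := nuX₄ r s ν₁ ν₂ ν₃ ∘ₗ nuX₁ r s ν₁ ν₃)
      (g := r ^ 2 • (nuX₁ r s ν₁ ν₃ ∘ₗ nuX₄ r s ν₁ ν₂ ν₃) + nuX₂ r s ν₁ ν₃)
      (ext_nu fun a b hb => ?_)
    simp only [LinearMap.comp_apply, LinearMap.smul_apply, LinearMap.add_apply]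
    rw [nuX₂_apply _ _ _ _ _ hb, nuX₄_apply h _ _ _ _ hb, map_smul, map_sub, map_smul, map_smul,
      x1 _ _ hb, i1]
    rcases b with _ | b
    · rw [nuX₁_zero, nuX₁_zero, map_zero, smul_zero, sub_zero, hD, hE, hF,
        smul_smul, smul_smul, smul_smul, ← add_smul]
      symm
      convert zero_smul ℂ _
      field_simp
      ring
    · rw [nuX₁_succ _ _ _ _ _ hb, map_smul, nuX₄_apply h _ _ _ _ (by omega), i2,
        nuX₁_succ _ _ _ _ _ hb, i1, ee _ _ hb, hval (a), hval' a, hD, hE, hF, hqq, hqq, h4, h4]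
      simp only [pow_succ _ (b + 1), pow_succ _ b]
      have hb1 : (s ^ 2) ^ b ≠ 0 := pow_ne_zero _ (pow_ne_zero _ hs)
      have hb2 : (r ^ 2) ^ b ≠ 0 := pow_ne_zero _ (pow_ne_zero _ hr)
      generalize (s ^ 2) ^ b = S at *
      generalize (r ^ 2) ^ b = R at *
      generalize (r * s) ^ (a - 1).val = T at *
      match_scalars
      · field_simp
        ring
      · field_simp
  · refine LinearMap.congr_fun (f := nuX₄ r s ν₁ ν₂ ν₃ ∘ₗ nuX₂ r s ν₁ ν₃)
      (g := s ^ 2 • (nuX₂ r s ν₁ ν₃ ∘ₗ nuX₄ r s ν₁ ν₂ ν₃) - s ^ 2 • nuX₃ r s ν₂ ν₃)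
      (ext_nu fun a b hb => ?_)
    simp only [LinearMap.comp_apply, LinearMap.smul_apply, LinearMap.sub_apply]
    rw [nuX₂_apply _ _ _ _ _ hb, map_smul, nuX₄_apply h _ _ _ _ hb, nuX₄_apply h _ _ _ _ hb,
      map_smul, map_sub, map_smul, map_smul, x2 _ _ (by omega), nuX₂_apply _ _ _ _ _ hb,
      nuX₃_apply _ _ _ _ _ hb, add_sub_cancel_right, sub_add_cancel, hval' a, hD, pow_succ _ b]
    have hb1 : (s ^ 2) ^ b ≠ 0 := pow_ne_zero _ (pow_ne_zero _ hs)
    generalize (s ^ 2) ^ b = S at *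
    generalize (r * s) ^ (a - 1).val = T at *
    match_scalars
    · field_simp
    · field_simp
      ring
  · refine LinearMap.congr_fun (f := nuX₄ r s ν₁ ν₂ ν₃ ∘ₗ nuX₃ r s ν₂ ν₃)
      (g := (r * s) • (nuX₃ r s ν₂ ν₃ ∘ₗ nuX₄ r s ν₁ ν₂ ν₃)) (ext_nu fun a b hb => ?_)
    simp only [LinearMap.comp_apply, LinearMap.smul_apply]
    have x3 : ∀ a, nuX₃ r s ν₂ ν₃ (eNu' r s ν₃ a (b + 1))
        = ((r * s) ^ a.val * (ν₂ : ℂ)) • eNu' r s ν₃ a (b + 1) := by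
      intro a
      unfold eNu'
      split_ifs with hc
      · rw [map_smul, nuX₃_apply _ _ _ _ _ hm, smul_comm]
      · exact nuX₃_apply _ _ _ _ _ (by omega)
    rw [nuX₃_apply _ _ _ _ _ hb, map_smul, nuX₄_apply h _ _ _ _ hb, map_smul, map_sub, map_smul,
      map_smul, x3, nuX₃_apply _ _ _ _ _ hb, hval' a]
    module

/-- The right `U⁺_{r,s}(B₂)`-module `M(ν)`, `ν = (ν₁, ν₂, ν₃) ∈ (ℂ*)² × ℂ`. -/
def MNu {r s : ℂ} (_ : Params r s) (_ _ : ℂˣ) (ν₃ : ℂ) : Type := VNu r s ν₃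

noncomputable instance {r s : ℂ} (h : Params r s) (ν₁ ν₂ : ℂˣ) (ν₃ : ℂ) :
    AddCommGroup (MNu h ν₁ ν₂ ν₃) := inferInstanceAs (AddCommGroup (VNu r s ν₃))

noncomputable instance {r s : ℂ} (h : Params r s) (ν₁ ν₂ : ℂˣ) (ν₃ : ℂ) :
    Module ℂ (MNu h ν₁ ν₂ ν₃) := inferInstanceAs (Module ℂ (VNu r s ν₃))

noncomputable instance {r s : ℂ} (h : Params r s) (ν₁ ν₂ : ℂˣ) (ν₃ : ℂ) :
    Module (UPlus r s)ᵐᵒᵖ (MNu h ν₁ ν₂ ν₃) :=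
  (nu_isAction h ν₁ ν₂ ν₃).module

/-- The generators act on `M(ν)` by the prescribed operators. -/
theorem MNu.smul_X {r s : ℂ} (h : Params r s) (ν₁ ν₂ : ℂˣ) (ν₃ : ℂ) (v : MNu h ν₁ ν₂ ν₃) :
    MulOpposite.op (X₁ r s) • v = nuX₁ r s ν₁ ν₃ v ∧
    MulOpposite.op (X₂ r s) • v = nuX₂ r s ν₁ ν₃ v ∧
    MulOpposite.op (X₃ r s) • v = nuX₃ r s ν₂ ν₃ v ∧
    MulOpposite.op (X₄ r s) • v = nuX₄ r s ν₁ ν₂ ν₃ v := by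
  have H := nu_isAction h ν₁ ν₂ ν₃
  refine ⟨?_, ?_, ?_, ?_⟩
  · exact congrArg (fun f : (Module.End ℂ (VNu r s ν₃))ᵐᵒᵖ => MulOpposite.unop f v) H.hom_X₁
  · exact congrArg (fun f : (Module.End ℂ (VNu r s ν₃))ᵐᵒᵖ => MulOpposite.unop f v) H.hom_X₂
  · exact congrArg (fun f : (Module.End ℂ (VNu r s ν₃))ᵐᵒᵖ => MulOpposite.unop f v) (H.hom_X₃ h.s_ne)
  · exact congrArg (fun f : (Module.End ℂ (VNu r s ν₃))ᵐᵒᵖ => MulOpposite.unop f v) H.hom_X₄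

/-! ### The modules `M(ξ)` -/

open Classical in
/-- `ℓ₄ = lcm(ord(rs), ord(rs⁻¹))` if `ξ₂ ≠ 0`, else `ord(rs⁻¹)`. -/
noncomputable def ell₄ (r s ξ₂ : ℂ) : ℕ :=
  if ξ₂ ≠ 0 then Nat.lcm (orderOf (r * s)) (orderOf (r * s⁻¹)) else orderOf (r * s⁻¹)

/-- The vector space with basis `e(a)`, `0 ≤ a < ℓ₄`. -/
abbrev VXi (r s ξ₂ : ℂ) : Type := Fin (ell₄ r s ξ₂) →₀ ℂ

/-- The basis vector `e(a)` (with `e(a) = 0` for `a` out of range, which is never used). -/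
noncomputable def eXi (r s ξ₂ : ℂ) (a : ℕ) : VXi r s ξ₂ :=
  if ha : a < ell₄ r s ξ₂ then Finsupp.single ⟨a, ha⟩ 1 else 0

noncomputable def xiX₁ (r s : ℂ) (ξ₁ : ℂˣ) (ξ₂ : ℂ) : Module.End ℂ (VXi r s ξ₂) :=
  Finsupp.linearCombination ℂ fun a : Fin (ell₄ r s ξ₂) =>
    if (a : ℕ) = 0 ∨ (a : ℕ) = 1 then 0 else
      (-(r ^ (-2 * ((a : ℤ) - 1))) * ((1 - (r * s⁻¹) ^ ((a : ℕ) - 1)) / (1 - r * s⁻¹))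
        * ((1 - (r * s⁻¹) ^ (a : ℕ)) / (1 - (r * s⁻¹) ^ 2)) * (ξ₁ : ℂ)) • eXi r s ξ₂ (a - 2)

noncomputable def xiX₂ (r s : ℂ) (ξ₁ : ℂˣ) (ξ₂ : ℂ) : Module.End ℂ (VXi r s ξ₂) :=
  Finsupp.linearCombination ℂ fun a : Fin (ell₄ r s ξ₂) =>
    if (a : ℕ) = 0 then 0 else
      ((r * s) ^ (-((a : ℤ) - 1)) * ((1 - (r * s⁻¹) ^ (a : ℕ)) / (1 - r * s⁻¹)) * (ξ₁ : ℂ))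
        • eXi r s ξ₂ (a - 1)

noncomputable def xiX₃ (r s : ℂ) (ξ₁ : ℂˣ) (ξ₂ : ℂ) : Module.End ℂ (VXi r s ξ₂) :=
  Finsupp.linearCombination ℂ fun a : Fin (ell₄ r s ξ₂) =>
    ((r * s) ^ (-(a : ℤ)) * (ξ₁ : ℂ)) • eXi r s ξ₂ a

noncomputable def xiX₄ (r s ξ₂ : ℂ) : Module.End ℂ (VXi r s ξ₂) :=
  Finsupp.linearCombination ℂ fun a : Fin (ell₄ r s ξ₂) =>
    if (a : ℕ) = ell₄ r s ξ₂ - 1 then ξ₂ • eXi r s ξ₂ 0 else eXi r s ξ₂ (a + 1)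

theorem p_pow_ell₄ (r s ξ₂ : ℂ) : (r * s⁻¹) ^ ell₄ r s ξ₂ = 1 := by
  unfold ell₄
  split_ifs
  · exact orderOf_dvd_iff_pow_eq_one.1 (Nat.dvd_lcm_right _ _)
  · exact pow_orderOf_eq_one _

theorem rs_pow_ell₄ (r s ξ₂ : ℂ) : (r * s) ^ ell₄ r s ξ₂ * ξ₂ = ξ₂ := by
  by_cases h0 : ξ₂ = 0
  · simp [h0]
  unfold ell₄
  rw [if_pos h0, orderOf_dvd_iff_pow_eq_one.1 (Nat.dvd_lcm_left _ _), one_mul]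

theorem ell₄_pos {r s : ℂ} (h : Params r s) (ξ₂ : ℂ) : 0 < ell₄ r s ξ₂ := by
  unfold ell₄
  split_ifs
  · exact Nat.lcm_pos h.ord_rs_pos h.ord_p_pos
  · exact h.ord_p_pos

theorem ext_xi {r s ξ₂ : ℂ} {W : Type*} [AddCommGroup W] [Module ℂ W] {f g : VXi r s ξ₂ →ₗ[ℂ] W}
    (h : ∀ a, a < ell₄ r s ξ₂ → f (eXi r s ξ₂ a) = g (eXi r s ξ₂ a)) : f = g := by
  refine Finsupp.lhom_ext' fun p => LinearMap.ext_ring ?_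
  have := h p p.2
  simpa [eXi] using this

/-- `e(a)` for `a < ℓ₄`, continued by `e(ℓ₄) = ξ₂ e(0)`. -/
noncomputable def eXi' (r s ξ₂ : ℂ) (a : ℕ) : VXi r s ξ₂ :=
  if a = ell₄ r s ξ₂ then ξ₂ • eXi r s ξ₂ 0 else eXi r s ξ₂ a

theorem xiX₁_zero (r s : ℂ) (ξ₁ : ℂˣ) (ξ₂ : ℂ) : xiX₁ r s ξ₁ ξ₂ (eXi r s ξ₂ 0) = 0 := by
  unfold xiX₁
  rw [eXi]
  split_ifs <;> simp

theorem xiX₁_one (r s : ℂ) (ξ₁ : ℂˣ) (ξ₂ : ℂ) : xiX₁ r s ξ₁ ξ₂ (eXi r s ξ₂ 1) = 0 := by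
  unfold xiX₁
  rw [eXi]
  split_ifs <;> simp

theorem xiX₁_succ (r s : ℂ) (ξ₁ : ℂˣ) (ξ₂ : ℂ) {a : ℕ} (ha : a + 2 < ell₄ r s ξ₂) :
    xiX₁ r s ξ₁ ξ₂ (eXi r s ξ₂ (a + 2)) =
      (-((r ^ 2) ^ (a + 1))⁻¹ * ((1 - (r * s⁻¹) ^ (a + 1)) / (1 - r * s⁻¹))
        * ((1 - (r * s⁻¹) ^ (a + 2)) / (1 - (r * s⁻¹) ^ 2)) * (ξ₁ : ℂ)) • eXi r s ξ₂ a := by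
  have e : r ^ (-2 * (((a + 2 : ℕ) : ℤ) - 1)) = ((r ^ 2) ^ (a + 1))⁻¹ := by
    rw [← pow_mul, ← zpow_natCast, ← zpow_neg]
    congr 1
    push_cast
    ring
  unfold xiX₁
  rw [eXi, dif_pos ha, Finsupp.linearCombination_single, one_smul]
  dsimp only
  rw [if_neg (by omega), e]
  rfl

theorem xiX₂_zero (r s : ℂ) (ξ₁ : ℂˣ) (ξ₂ : ℂ) : xiX₂ r s ξ₁ ξ₂ (eXi r s ξ₂ 0) = 0 := by
  unfold xiX₂
  rw [eXi]
  split_ifs <;> simp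

theorem xiX₂_succ (r s : ℂ) (ξ₁ : ℂˣ) (ξ₂ : ℂ) {a : ℕ} (ha : a + 1 < ell₄ r s ξ₂) :
    xiX₂ r s ξ₁ ξ₂ (eXi r s ξ₂ (a + 1)) =
      (((r * s) ^ a)⁻¹ * ((1 - (r * s⁻¹) ^ (a + 1)) / (1 - r * s⁻¹)) * (ξ₁ : ℂ))
        • eXi r s ξ₂ a := by
  have e : (r * s) ^ (-(((a + 1 : ℕ) : ℤ) - 1)) = ((r * s) ^ a)⁻¹ := by
    rw [← zpow_natCast, ← zpow_neg]
    congr 1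
    push_cast
    ring
  unfold xiX₂
  rw [eXi, dif_pos ha, Finsupp.linearCombination_single, one_smul]
  dsimp only
  rw [if_neg (by omega), e]
  rfl

theorem xiX₃_apply (r s : ℂ) (ξ₁ : ℂˣ) (ξ₂ : ℂ) {a : ℕ} (ha : a < ell₄ r s ξ₂) :
    xiX₃ r s ξ₁ ξ₂ (eXi r s ξ₂ a) = (((r * s) ^ a)⁻¹ * (ξ₁ : ℂ)) • eXi r s ξ₂ a := by
  have e : (r * s) ^ (-(a : ℤ)) = ((r * s) ^ a)⁻¹ := by
    rw [← zpow_natCast, ← zpow_neg]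
  unfold xiX₃
  rw [eXi, dif_pos ha, Finsupp.linearCombination_single, one_smul]
  simp only [eXi, dif_pos ha, e]

theorem xiX₄_apply (r s ξ₂ : ℂ) {a : ℕ} (ha : a < ell₄ r s ξ₂) :
    xiX₄ r s ξ₂ (eXi r s ξ₂ a) = eXi' r s ξ₂ (a + 1) := by
  unfold xiX₄
  rw [show eXi r s ξ₂ a = Finsupp.single ⟨a, ha⟩ 1 from dif_pos ha, Finsupp.linearCombination_single, one_smul]
  unfold eXi'
  dsimp only
  by_cases hc : a = ell₄ r s ξ₂ - 1
  · rw [if_pos hc, if_pos (by omega)]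
  · rw [if_neg hc, if_neg (by omega)]

theorem xi_isAction {r s : ℂ} (h : Params r s) (ξ₁ : ℂˣ) (ξ₂ : ℂ) :
    IsAction r s (xiX₁ r s ξ₁ ξ₂) (xiX₂ r s ξ₁ ξ₂) (xiX₃ r s ξ₁ ξ₂) (xiX₄ r s ξ₂) := by
  have hr := h.r_ne
  have hs := h.s_ne
  have hn := ξ₁.ne_zero
  have hsub := h.sub_ne
  have hadd := h.add_ne
  have hsub' : s - r ≠ 0 := fun e => hsub (by rw [← neg_sub, e, neg_zero])
  have hE : (1 - r * s⁻¹) = (s - r) / s := by field_simp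
  have hF : (1 - (r * s⁻¹) ^ 2) = (s - r) * (r + s) / s ^ 2 := by field_simp; ring
  have hm := ell₄_pos h ξ₂
  have hp : ∀ a, (r * s⁻¹) ^ a = r ^ a / s ^ a := fun a => by
    rw [← div_eq_mul_inv, div_pow]
  -- the action of X₁, X₂ and X₃ on the continued basis
  have x1 : ∀ a, a + 1 < ell₄ r s ξ₂ → xiX₁ r s ξ₁ ξ₂ (eXi' r s ξ₂ (a + 2)) =
      (-((r ^ 2) ^ (a + 1))⁻¹ * ((1 - (r * s⁻¹) ^ (a + 1)) / (1 - r * s⁻¹))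
        * ((1 - (r * s⁻¹) ^ (a + 2)) / (1 - (r * s⁻¹) ^ 2)) * (ξ₁ : ℂ)) • eXi r s ξ₂ a := by
    intro a ha
    unfold eXi'
    split_ifs with hc
    · rw [map_smul, xiX₁_zero, hc, p_pow_ell₄]
      simp
    · exact xiX₁_succ _ _ _ _ (by omega)
  have x11 : xiX₁ r s ξ₁ ξ₂ (eXi' r s ξ₂ 1) = 0 := by
    unfold eXi'
    split_ifs with hc
    · rw [map_smul, xiX₁_zero, smul_zero]
    · exact xiX₁_one _ _ _ _
  have x2 : ∀ a, a < ell₄ r s ξ₂ → xiX₂ r s ξ₁ ξ₂ (eXi' r s ξ₂ (a + 1)) =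
      (((r * s) ^ a)⁻¹ * ((1 - (r * s⁻¹) ^ (a + 1)) / (1 - r * s⁻¹)) * (ξ₁ : ℂ))
        • eXi r s ξ₂ a := by
    intro a ha
    unfold eXi'
    split_ifs with hc
    · rw [map_smul, xiX₂_zero, hc, p_pow_ell₄]
      simp
    · exact xiX₂_succ _ _ _ _ (by omega)
  have x3 : ∀ a, a ≤ ell₄ r s ξ₂ → xiX₃ r s ξ₁ ξ₂ (eXi' r s ξ₂ a)
      = (((r * s) ^ a)⁻¹ * (ξ₁ : ℂ)) • eXi' r s ξ₂ a := by
    intro a ha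
    unfold eXi'
    split_ifs with hc
    · rw [map_smul, xiX₃_apply _ _ _ _ hm, smul_smul, smul_smul, hc]
      congr 1
      have := rs_pow_ell₄ r s ξ₂
      have h0 : (r * s) ^ ell₄ r s ξ₂ ≠ 0 := pow_ne_zero _ (mul_ne_zero hr hs)
      rw [pow_zero, inv_one, one_mul, mul_right_comm]
      congr 1
      field_simp
      rw [mul_comm]
      exact this
    · exact xiX₃_apply _ _ _ _ (by omega)
  have ee : ∀ a, a < ell₄ r s ξ₂ → eXi' r s ξ₂ a = eXi r s ξ₂ a := fun a ha => by
    rw [eXi', if_neg ha.ne]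
  refine ⟨?_, ?_, ?_, ?_⟩
  · refine LinearMap.congr_fun (f := xiX₂ r s ξ₁ ξ₂ ∘ₗ xiX₁ r s ξ₁ ξ₂)
      (g := s ^ 2 • (xiX₁ r s ξ₁ ξ₂ ∘ₗ xiX₂ r s ξ₁ ξ₂)) (ext_xi fun a ha => ?_)
    simp only [LinearMap.comp_apply, LinearMap.smul_apply]
    rcases a with _ | _ | _ | a
    · simp [xiX₁_zero, xiX₂_zero]
    · simp [xiX₁_one, xiX₂_succ _ _ _ _ ha, xiX₁_zero]
    · rw [xiX₁_succ _ _ _ _ ha, xiX₂_succ _ _ _ _ ha, map_smul, map_smul, xiX₂_zero, zero_add,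
        xiX₁_one]
      simp
    · rw [xiX₁_succ _ _ _ _ ha, xiX₂_succ _ _ _ _ ha, map_smul, map_smul,
        xiX₂_succ _ _ _ _ (by omega), xiX₁_succ _ _ _ _ (by omega), smul_smul, smul_smul,
        smul_smul, hE, hF]
      congr 1
      field_simp
      ring
  · refine LinearMap.congr_fun (f := xiX₄ r s ξ₂ ∘ₗ xiX₁ r s ξ₁ ξ₂)
      (g := r ^ 2 • (xiX₁ r s ξ₁ ξ₂ ∘ₗ xiX₄ r s ξ₂) + xiX₂ r s ξ₁ ξ₂) (ext_xi fun a ha => ?_)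
    simp only [LinearMap.comp_apply, LinearMap.smul_apply, LinearMap.add_apply]
    rw [xiX₄_apply _ _ _ ha]
    rcases a with _ | _ | a
    · rw [x11]
      simp [xiX₁_zero, xiX₂_zero]
    · rw [x1 _ ha, xiX₂_succ _ _ _ _ ha, zero_add, xiX₁_one, map_zero, smul_smul, ← add_smul,
        hE, hF]
      symm
      convert zero_smul ℂ _
      simp only [hp]
      field_simp
      ring
    · rw [x1 _ ha, xiX₂_succ _ _ _ _ ha, xiX₁_succ _ _ _ _ ha, map_smul,
        xiX₄_apply _ _ _ (by omega), ee _ (by omega), smul_smul, ← add_smul, hE, hF]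
      congr 1
      simp only [hp]
      field_simp
      ring
  · refine LinearMap.congr_fun (f := xiX₄ r s ξ₂ ∘ₗ xiX₂ r s ξ₁ ξ₂)
      (g := s ^ 2 • (xiX₂ r s ξ₁ ξ₂ ∘ₗ xiX₄ r s ξ₂) - s ^ 2 • xiX₃ r s ξ₁ ξ₂)
      (ext_xi fun a ha => ?_)
    simp only [LinearMap.comp_apply, LinearMap.smul_apply, LinearMap.sub_apply]
    rw [xiX₄_apply _ _ _ ha, x2 _ ha, xiX₃_apply _ _ _ _ ha]
    rcases a with _ | a
    · rw [xiX₂_zero, map_zero, zero_add, pow_one, div_self (by rw [hE]; exact div_ne_zero hsub' hs),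
        mul_one, sub_self]
    · rw [xiX₂_succ _ _ _ _ ha, map_smul, xiX₄_apply _ _ _ (by omega), ee _ (by omega),
        smul_smul, smul_smul, ← sub_smul, hE]
      congr 1
      simp only [hp]
      field_simp
      ring
  · refine LinearMap.congr_fun (f := xiX₄ r s ξ₂ ∘ₗ xiX₃ r s ξ₁ ξ₂)
      (g := (r * s) • (xiX₃ r s ξ₁ ξ₂ ∘ₗ xiX₄ r s ξ₂)) (ext_xi fun a ha => ?_)
    simp only [LinearMap.comp_apply, LinearMap.smul_apply]
    rw [xiX₃_apply _ _ _ _ ha, map_smul, xiX₄_apply _ _ _ ha, x3 _ (by omega), smul_smul]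
    congr 1
    field_simp
    ring

/-- The right `U⁺_{r,s}(B₂)`-module `M(ξ)`, `ξ = (ξ₁, ξ₂) ∈ ℂ* × ℂ`. -/
def MXi {r s : ℂ} (_ : Params r s) (_ : ℂˣ) (ξ₂ : ℂ) : Type := VXi r s ξ₂

noncomputable instance {r s : ℂ} (h : Params r s) (ξ₁ : ℂˣ) (ξ₂ : ℂ) :
    AddCommGroup (MXi h ξ₁ ξ₂) := inferInstanceAs (AddCommGroup (VXi r s ξ₂))

noncomputable instance {r s : ℂ} (h : Params r s) (ξ₁ : ℂˣ) (ξ₂ : ℂ) :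
    Module ℂ (MXi h ξ₁ ξ₂) := inferInstanceAs (Module ℂ (VXi r s ξ₂))

noncomputable instance {r s : ℂ} (h : Params r s) (ξ₁ : ℂˣ) (ξ₂ : ℂ) :
    Module (UPlus r s)ᵐᵒᵖ (MXi h ξ₁ ξ₂) :=
  (xi_isAction h ξ₁ ξ₂).module

/-- The generators act on `M(ξ)` by the prescribed operators. -/
theorem MXi.smul_X {r s : ℂ} (h : Params r s) (ξ₁ : ℂˣ) (ξ₂ : ℂ) (v : MXi h ξ₁ ξ₂) :
    MulOpposite.op (X₁ r s) • v = xiX₁ r s ξ₁ ξ₂ v ∧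
    MulOpposite.op (X₂ r s) • v = xiX₂ r s ξ₁ ξ₂ v ∧
    MulOpposite.op (X₃ r s) • v = xiX₃ r s ξ₁ ξ₂ v ∧
    MulOpposite.op (X₄ r s) • v = xiX₄ r s ξ₂ v := by
  have H := xi_isAction h ξ₁ ξ₂
  refine ⟨?_, ?_, ?_, ?_⟩
  · exact congrArg (fun f : (Module.End ℂ (VXi r s ξ₂))ᵐᵒᵖ => MulOpposite.unop f v) H.hom_X₁
  · exact congrArg (fun f : (Module.End ℂ (VXi r s ξ₂))ᵐᵒᵖ => MulOpposite.unop f v) H.hom_X₂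
  · exact congrArg (fun f : (Module.End ℂ (VXi r s ξ₂))ᵐᵒᵖ => MulOpposite.unop f v) (H.hom_X₃ h.s_ne)
  · exact congrArg (fun f : (Module.End ℂ (VXi r s ξ₂))ᵐᵒᵖ => MulOpposite.unop f v) H.hom_X₄

end UB2

/-!
A simple module on which `X₁` is nilpotent and `X₃` invertible contains a vector that behaves like
the first basis vector of one of the model modules, and such a vector determines the module.

The generators satisfy `X₁X₂ = s²X₂X₁`, `X₁X₃ = r²s²X₃X₁`, `X₂X₃ = rsX₃X₂`, `X₃X₄ = rsX₄X₃`, and the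
element `z = X₃ + (s⁻² - r⁻¹s⁻¹)X₂X₄` commutes up to scalars with `X₂`, `X₃`, `X₄`. If `x y - p y x`
commutes with `y` up to a factor `q ≠ p`, then `x` commutes with `yⁿ` whenever `pⁿ = qⁿ = 1`
(`mul_pow_of_two_factors`; there is a version for cubic relations). Hence `X₂ˡ`, `X₃ˡ`, `X₄ˡ` and `zˡ`
are central. The algebra has countable dimension over `ℂ`, so by Schur's lemma
(`exists_act_eq_smul_of_mem_center`) these elements act on the simple module `N` by scalars; in
particular each of `X₂`, `X₃`, `X₄`, `z` satisfies a polynomial equation on `N` and has eigenvectors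
in every nonzero subspace that it preserves.

If `X₂ˡ` acts by zero, choose an eigenvector `v` of `X₃` in the common kernel of `X₁` and `X₂`. The
vectors `v X₄ᵃ` give a homomorphism from `M(ξ)` (`nonempty_equiv_MXi`). If `X₂ˡ` acts by a nonzero
scalar, choose in the kernel of `X₁` a joint eigenvector `v` of `X₃`, `X₂^ℓ₃` and `z^m₃`; the vectors
`ν₁⁻ᵃ v X₂ᵃ zᵇ` give a homomorphism from `M(ν)` (`nonempty_equiv_MNu`). When `X₄` or `z` is nilpotent,
simplicity forces `v X₄ⁿ = 0` with `n = ord(rs⁻¹)`, respectively `v zᵐ = 0` with `m = ord(r⁻²s²)`.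

The homomorphisms are surjective because `N` is simple. They are injective because the basis vectors
of the model have nonzero images that are joint eigenvectors with pairwise different systems of
eigenvalues, for `X₃` and `X₂X₄`, respectively for `X₃`, `X₂^ℓ₃` and `X₁zX₂^{2l-2}`; no separate proof
of the simplicity of the models is needed.
-/

namespace UB2

/-! ### Commutation relations in the algebra -/

section QCommutation

variable {E : Type*} [Ring E] [Algebra ℂ E]

theorem mul_pow_of_qcomm {x y : E} {q : ℂ} (h : x * y = q • (y * x)) (n : ℕ) :
    x * y ^ n = q ^ n • (y ^ n * x) := by
  induction n with
  | zero => simp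
  | succ n ih =>
    rw [pow_succ, ← mul_assoc, ih, smul_mul_assoc, mul_assoc, h, mul_smul_comm, smul_smul,
      ← mul_assoc, ← pow_succ]

theorem commute_pow_of_qcomm {x y : E} {q : ℂ} (h : x * y = q • (y * x)) {n : ℕ} (hq : q ^ n = 1) :
    Commute x (y ^ n) := by
  rw [Commute, SemiconjBy, mul_pow_of_qcomm h, hq, one_smul]

/-- If `w = x y - p y x` commutes with `y` up to a factor `q ≠ p`, then `u = x y - q y x` commutes
with `y` up to the factor `p`, and both `x y` and `y x` are combinations of `u` and `w`; hence `x`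
commutes with `yⁿ` up to the common value of `pⁿ` and `qⁿ`. -/
theorem mul_pow_of_two_factors {x y w : E} {p q : ℂ} (hx : x * y = p • (y * x) + w)
    (hw : w * y = q • (y * w)) (hpq : p ≠ q) {n : ℕ} (hn : 0 < n) (h : p ^ n = q ^ n) :
    x * y ^ n = p ^ n • (y ^ n * x) := by
  obtain ⟨n, rfl⟩ : ∃ k, n = k + 1 := ⟨n - 1, by omega⟩
  set u : E := w + (p - q) • (y * x) with hu
  have huy : u * y = p • (y * u) := by
    simp only [hu, add_mul, smul_mul_assoc, mul_assoc, hx, hw, mul_add, mul_smul_comm, smul_add]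
    module
  have hxy : (p - q) • (x * y) = p • u - q • w := by
    rw [hx, hu]; module
  have h1 : (p - q) • (x * y ^ (n + 1)) = (p - q) • (p ^ (n + 1) • (y ^ (n + 1) * x)) := by
    calc (p - q) • (x * y ^ (n + 1)) = ((p - q) • (x * y)) * y ^ n := by
          rw [pow_succ', smul_mul_assoc, mul_assoc]
      _ = p ^ (n + 1) • (y ^ n * u) - q ^ (n + 1) • (y ^ n * w) := by
          rw [hxy, sub_mul, smul_mul_assoc, smul_mul_assoc, mul_pow_of_qcomm huy,
            mul_pow_of_qcomm hw, smul_smul, smul_smul, pow_succ', pow_succ']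
      _ = _ := by
          rw [← h, hu, mul_add, mul_smul_comm, ← mul_assoc, ← pow_succ]
          module
  exact smul_right_injective E (sub_ne_zero.2 hpq) h1

/-- The cubic relation says that right multiplication `R` and left multiplication `L` by `y`
satisfy `(R - p L) (R - q L) (R - m L) x = 0`; Lagrange interpolation then expresses `R² x` and
`L² x` through elements on which `Rⁿ` is `pⁿ Lⁿ`, `qⁿ Lⁿ`, `mⁿ Lⁿ` respectively. -/
theorem mul_pow_of_three_factors {x y : E} {p q m : ℂ}
    (hx : x * y ^ 3 - (p + q + m) • (y * x * y ^ 2) + (p * q + p * m + q * m) • (y ^ 2 * x * y)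
      - (p * q * m) • (y ^ 3 * x) = 0)
    (hpq : p ≠ q) (hpm : p ≠ m) (hqm : q ≠ m) {n : ℕ} (hn : 2 ≤ n)
    (hq : p ^ n = q ^ n) (hm : p ^ n = m ^ n) : x * y ^ n = p ^ n • (y ^ n * x) := by
  obtain ⟨n, rfl⟩ : ∃ k, n = k + 2 := ⟨n - 2, by omega⟩
  have key : ∀ a b c : ℂ, a + b + c = p + q + m → a * b + a * c + b * c = p * q + p * m + q * m →
      a * b * c = p * q * m →
      (x * y ^ 2 - (b + c) • (y * x * y) + (b * c) • (y ^ 2 * x)) * y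
        = a • (y * (x * y ^ 2 - (b + c) • (y * x * y) + (b * c) • (y ^ 2 * x))) := by
    intro a b c h1 h2 h3
    rw [← h1, ← h2, ← h3] at hx
    rw [← sub_eq_zero, ← hx]
    simp only [mul_sub, mul_add, sub_mul, add_mul, smul_mul_assoc, mul_smul_comm, mul_assoc,
      pow_succ, pow_zero, one_mul]
    module
  have hU := mul_pow_of_qcomm (key p q m rfl rfl rfl) n
  have hV := mul_pow_of_qcomm (key q p m (by ring) (by ring) (by ring)) n
  have hW := mul_pow_of_qcomm (key m p q (by ring) (by ring) (by ring)) n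
  set U := x * y ^ 2 - (q + m) • (y * x * y) + (q * m) • (y ^ 2 * x) with hUd
  set V := x * y ^ 2 - (p + m) • (y * x * y) + (p * m) • (y ^ 2 * x) with hVd
  set W := x * y ^ 2 - (p + q) • (y * x * y) + (p * q) • (y ^ 2 * x) with hWd
  have e1 : ((p - q) * (p - m) * (q - m)) • (x * y ^ 2)
      = (p ^ 2 * (q - m)) • U - (q ^ 2 * (p - m)) • V + (m ^ 2 * (p - q)) • W := by
    rw [hUd, hVd, hWd]; module
  have e2 : ((p - q) * (p - m) * (q - m)) • (y ^ 2 * x)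
      = (q - m) • U - (p - m) • V + (p - q) • W := by
    rw [hUd, hVd, hWd]; module
  clear_value U V W
  have hD : (p - q) * (p - m) * (q - m) ≠ 0 :=
    mul_ne_zero (mul_ne_zero (sub_ne_zero.2 hpq) (sub_ne_zero.2 hpm)) (sub_ne_zero.2 hqm)
  refine smul_right_injective E hD ?_
  change _ • (x * y ^ (n + 2)) = _ • (p ^ (n + 2) • (y ^ (n + 2) * x))
  calc _ = (((p - q) * (p - m) * (q - m)) • (x * y ^ 2)) * y ^ n := by
        rw [smul_mul_assoc, mul_assoc x, ← pow_add, add_comm 2]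
    _ = (p ^ (n + 2) * (q - m)) • (y ^ n * U) - (q ^ (n + 2) * (p - m)) • (y ^ n * V)
        + (m ^ (n + 2) * (p - q)) • (y ^ n * W) := by
        rw [e1, add_mul, sub_mul, smul_mul_assoc, smul_mul_assoc, smul_mul_assoc, hU, hV, hW]
        module
    _ = p ^ (n + 2) • (y ^ n * (((p - q) * (p - m) * (q - m)) • (y ^ 2 * x))) := by
        rw [e2, ← hq, ← hm]
        simp only [mul_add, mul_sub, mul_smul_comm]
        module
    _ = _ := by
        rw [mul_smul_comm, ← mul_assoc, ← pow_add, smul_comm]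

end QCommutation

section Algebra

variable {r s : ℂ}

theorem adjoin_X (r s : ℂ) : Algebra.adjoin ℂ {X₁ r s, X₄ r s} = ⊤ := by
  have h := congrArg (Subalgebra.map (RingQuot.mkAlgHom ℂ (Rel r s)))
    (FreeAlgebra.adjoin_range_ι ℂ (Fin 2))
  rw [AlgHom.map_adjoin, ← Set.range_comp, Algebra.map_top,
    (AlgHom.range_eq_top _).2 (RingQuot.mkAlgHom_surjective ℂ (Rel r s))] at h
  refine Eq.trans (congrArg _ ?_) h
  ext x
  rw [Set.mem_insert_iff, Set.mem_singleton_iff, eq_comm (a := x), eq_comm (a := x)]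
  exact (Fin.exists_fin_two (p := fun i => RingQuot.mkAlgHom ℂ (Rel r s) (FreeAlgebra.ι ℂ i)
    = x)).symm

theorem mem_center_of_commute {z : UPlus r s} (h₁ : Commute (X₁ r s) z)
    (h₄ : Commute (X₄ r s) z) : z ∈ Subalgebra.center ℂ (UPlus r s) := by
  rw [Subalgebra.mem_center_iff]
  intro b
  have hb : b ∈ Algebra.adjoin ℂ {X₁ r s, X₄ r s} := by rw [adjoin_X]; trivial
  induction hb using Algebra.adjoin_induction with
  | mem x hx =>
    rcases hx with rfl | rfl
    · exact h₁
    · exact h₄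
  | algebraMap c => exact Algebra.commutes c z
  | add x y _ _ hx hy => rw [add_mul, mul_add, hx, hy]
  | mul x y _ _ hx hy => rw [mul_assoc, hy, ← mul_assoc, hx, mul_assoc]

theorem X₁_mul_X₄ (r s : ℂ) :
    X₁ r s * X₄ r s = r ^ 2 • (X₄ r s * X₁ r s) + X₂ r s := by
  change e₁ r s * e₂ r s = r ^ 2 • (e₂ r s * e₁ r s)
    + (e₁ r s * e₂ r s - r ^ 2 • (e₂ r s * e₁ r s))
  abel

theorem serre_one (r s : ℂ) : X₁ r s ^ 2 * X₄ r s - (r ^ 2 + s ^ 2) • (X₁ r s * X₄ r s * X₁ r s)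
    + (r ^ 2 * s ^ 2) • (X₄ r s * X₁ r s ^ 2) = 0 := by
  have := RingQuot.mkAlgHom_rel ℂ (Rel.serre₁ (r := r) (s := s) _ _ rfl rfl)
  simp only [map_add, map_sub, map_smul, map_mul, map_pow, map_zero] at this
  exact this

theorem serre_two (r s : ℂ) : X₁ r s * X₄ r s ^ 3
    - (r ^ 2 + r * s + s ^ 2) • (X₄ r s * X₁ r s * X₄ r s ^ 2)
    + (r * s * (r ^ 2 + r * s + s ^ 2)) • (X₄ r s ^ 2 * X₁ r s * X₄ r s)
    - (r ^ 3 * s ^ 3) • (X₄ r s ^ 3 * X₁ r s) = 0 := by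
  have := RingQuot.mkAlgHom_rel ℂ (Rel.serre₂ (r := r) (s := s) _ _ rfl rfl)
  simp only [map_add, map_sub, map_smul, map_mul, map_pow, map_zero] at this
  exact this

theorem X₂_eq (r s : ℂ) : X₂ r s = X₁ r s * X₄ r s - r ^ 2 • (X₄ r s * X₁ r s) := rfl

theorem X₃_eq (r s : ℂ) : X₃ r s = X₄ r s * X₂ r s - (s ^ 2)⁻¹ • (X₂ r s * X₄ r s) := rfl

theorem X₁_mul_X₂ (r s : ℂ) : X₁ r s * X₂ r s = s ^ 2 • (X₂ r s * X₁ r s) := by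
  rw [← sub_eq_zero, ← serre_one r s, X₂_eq]
  simp only [mul_sub, sub_mul, smul_mul_assoc, mul_smul_comm, mul_assoc, pow_succ, pow_zero,
    one_mul]
  module

theorem X₂_mul_X₄ (h : Params r s) :
    X₂ r s * X₄ r s = s ^ 2 • (X₄ r s * X₂ r s) - s ^ 2 • X₃ r s := by
  have hs := h.s_ne
  rw [X₃_eq, smul_sub, smul_smul, mul_inv_cancel₀ (pow_ne_zero 2 hs)]
  module

theorem X₄_mul_X₂ (r s : ℂ) :
    X₄ r s * X₂ r s = (s ^ 2)⁻¹ • (X₂ r s * X₄ r s) + X₃ r s := by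
  rw [X₃_eq]
  abel

theorem X₃_mul_X₄ (h : Params r s) : X₃ r s * X₄ r s = (r * s) • (X₄ r s * X₃ r s) := by
  have hs := h.s_ne
  refine smul_right_injective _ (pow_ne_zero 2 hs) ?_
  change s ^ 2 • _ = s ^ 2 • _
  have e : s ^ 2 • X₃ r s = s ^ 2 • (X₄ r s * X₂ r s) - X₂ r s * X₄ r s := by
    rw [X₂_mul_X₄ h]; abel
  rw [smul_comm (s ^ 2), ← smul_mul_assoc, ← mul_smul_comm, e, ← sub_eq_zero, ← neg_eq_zero,
    ← serre_two r s, X₂_eq]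
  simp only [mul_sub, sub_mul, smul_mul_assoc, mul_smul_comm, mul_assoc, pow_succ, pow_zero,
    one_mul]
  module

theorem X₁_mul_X₃ (h : Params r s) :
    X₁ r s * X₃ r s = (r ^ 2 * s ^ 2) • (X₃ r s * X₁ r s) := by
  have hs := h.s_ne
  have h1 : X₁ r s * (X₄ r s * X₂ r s)
      = (r ^ 2 * s ^ 2) • (X₄ r s * X₂ r s * X₁ r s) + X₂ r s * X₂ r s := by
    rw [← mul_assoc, X₁_mul_X₄, add_mul, smul_mul_assoc, mul_assoc, X₁_mul_X₂]
    simp only [mul_smul_comm, mul_assoc, smul_smul]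
  have h2 : X₁ r s * (X₂ r s * X₄ r s)
      = (s ^ 2) • (r ^ 2 • (X₂ r s * X₄ r s * X₁ r s) + X₂ r s * X₂ r s) := by
    rw [← mul_assoc, X₁_mul_X₂, smul_mul_assoc, mul_assoc, X₁_mul_X₄]
    simp only [mul_add, mul_smul_comm, mul_assoc]
  rw [X₃_eq, mul_sub, mul_smul_comm, h1, h2, sub_mul, smul_mul_assoc]
  match_scalars <;> field_simp
  ring

theorem X₂_mul_X₃ (h : Params r s) : X₂ r s * X₃ r s = (r * s) • (X₃ r s * X₂ r s) := by
  have hr := h.r_ne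
  have hs := h.s_ne
  have h43 : X₄ r s * X₃ r s = (r * s)⁻¹ • (X₃ r s * X₄ r s) := by
    rw [X₃_mul_X₄ h, smul_smul, inv_mul_cancel₀ (mul_ne_zero hr hs), one_smul]
  have h1 : X₁ r s * X₄ r s * X₃ r s = (r * s) • (X₃ r s * (X₁ r s * X₄ r s)) := by
    rw [mul_assoc, h43, mul_smul_comm, ← mul_assoc, X₁_mul_X₃ h, smul_mul_assoc, smul_smul,
      mul_assoc]
    congr 1
    field_simp
  have h2 : X₄ r s * X₁ r s * X₃ r s = (r * s) • (X₃ r s * (X₄ r s * X₁ r s)) := by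
    rw [mul_assoc, X₁_mul_X₃ h, mul_smul_comm, ← mul_assoc, h43, smul_mul_assoc, smul_smul,
      mul_assoc]
    congr 1
    · field_simp
    · rw [mul_assoc]
  rw [X₂_eq, sub_mul, smul_mul_assoc, h1, h2, mul_sub, mul_smul_comm]
  module

theorem X₃_mul_X₂ (h : Params r s) : X₃ r s * X₂ r s = (r * s)⁻¹ • (X₂ r s * X₃ r s) := by
  rw [X₂_mul_X₃ h, smul_smul, inv_mul_cancel₀ (mul_ne_zero h.r_ne h.s_ne), one_smul]

/-- The element `z = X₃ + (s⁻² - r⁻¹s⁻¹) X₂ X₄`, which commutes with `X₂`, `X₃`, `X₄` up to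
scalars. In `M(ν)` it sends `e(a, b)` to `e(a, b + 1)`. -/
noncomputable def zElt (r s : ℂ) : UPlus r s :=
  X₃ r s + ((s ^ 2)⁻¹ - r⁻¹ * s⁻¹) • (X₂ r s * X₄ r s)

theorem X₃_mul_zElt (h : Params r s) : X₃ r s * zElt r s = zElt r s * X₃ r s := by
  have h1 : X₂ r s * X₄ r s * X₃ r s = X₃ r s * (X₂ r s * X₄ r s) := by
    refine smul_right_injective _ (mul_ne_zero h.r_ne h.s_ne) ?_
    change (r * s) • _ = (r * s) • _
    rw [mul_assoc, ← mul_smul_comm, ← X₃_mul_X₄ h, ← mul_assoc, X₂_mul_X₃ h, smul_mul_assoc,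
      mul_assoc]
  rw [zElt, add_mul, mul_add, smul_mul_assoc, mul_smul_comm, h1]

theorem X₂_mul_zElt (h : Params r s) : X₂ r s * zElt r s = s ^ 2 • (zElt r s * X₂ r s) := by
  have hr := h.r_ne
  have hs := h.s_ne
  have h1 : X₂ r s * (X₂ r s * X₄ r s)
      = s ^ 2 • (X₂ r s * X₄ r s * X₂ r s) - (s ^ 2 * (r * s)) • (X₃ r s * X₂ r s) := by
    conv_lhs => rw [X₂_mul_X₄ h, mul_sub, mul_smul_comm, mul_smul_comm, X₂_mul_X₃ h]
    rw [smul_smul, mul_assoc]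
  rw [zElt, mul_add, mul_smul_comm, h1, X₂_mul_X₃ h, add_mul, smul_mul_assoc]
  match_scalars <;> field_simp
  ring

theorem zElt_mul_X₄ (h : Params r s) : zElt r s * X₄ r s = s ^ 2 • (X₄ r s * zElt r s) := by
  have hr := h.r_ne
  have hs := h.s_ne
  have h1 : X₄ r s * (X₂ r s * X₄ r s)
      = (s ^ 2)⁻¹ • (X₂ r s * X₄ r s * X₄ r s) + (r * s) • (X₄ r s * X₃ r s) := by
    rw [← mul_assoc, X₄_mul_X₂, add_mul, smul_mul_assoc, X₃_mul_X₄ h]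
  rw [zElt, mul_add, mul_smul_comm, h1, add_mul, smul_mul_assoc, X₃_mul_X₄ h]
  match_scalars <;> field_simp
  ring

theorem X₁_mul_zElt (h : Params r s) :
    X₁ r s * zElt r s
      = (r ^ 2 * s ^ 2) • (zElt r s * X₁ r s) + (1 - r⁻¹ * s) • X₂ r s ^ 2 := by
  have hr := h.r_ne
  have hs := h.s_ne
  have h1 : X₁ r s * (X₂ r s * X₄ r s)
      = (s ^ 2) • (r ^ 2 • (X₂ r s * X₄ r s * X₁ r s) + X₂ r s * X₂ r s) := by
    rw [← mul_assoc, X₁_mul_X₂, smul_mul_assoc, mul_assoc, X₁_mul_X₄]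
    simp only [mul_add, mul_smul_comm, mul_assoc]
  rw [zElt, mul_add, mul_smul_comm, h1, X₁_mul_X₃ h, add_mul, smul_mul_assoc, pow_two (X₂ r s)]
  match_scalars <;> field_simp

theorem Params.sq_ne_mul (h : Params r s) : r ^ 2 ≠ r * s := fun e =>
  h.sub_ne (by
    have : r * (r - s) = 0 := by linear_combination e
    exact (mul_eq_zero.1 this).resolve_left h.r_ne)

theorem Params.mul_ne_sq (h : Params r s) : r * s ≠ s ^ 2 := fun e =>
  h.sub_ne (by
    have : s * (r - s) = 0 := by linear_combination e
    exact (mul_eq_zero.1 this).resolve_left h.s_ne)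

theorem sq_pow_eq_one (h : Params r s) {l : ℕ} (hl₁ : (r * s) ^ l = 1) (hl₂ : (r * s⁻¹) ^ l = 1) :
    (r ^ 2) ^ l = 1 ∧ (s ^ 2) ^ l = 1 := by
  have hs := h.s_ne
  have hr := h.r_ne
  have e1 : (r ^ 2) ^ l = (r * s) ^ l * (r * s⁻¹) ^ l := by
    rw [← mul_pow]; congr 1; field_simp
  have e2 : (s ^ 2) ^ l * (r * s⁻¹) ^ l = (r * s) ^ l := by
    rw [← mul_pow]; congr 1; field_simp
  rw [hl₁, hl₂] at *
  rw [mul_one] at e1 e2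
  exact ⟨e1, e2⟩

theorem X₂_pow_mem_center (h : Params r s) {l : ℕ} (hl : 0 < l) (hl₁ : (r * s) ^ l = 1)
    (hl₂ : (r * s⁻¹) ^ l = 1) : X₂ r s ^ l ∈ Subalgebra.center ℂ (UPlus r s) := by
  obtain ⟨hr2, hs2⟩ := sq_pow_eq_one h hl₁ hl₂
  refine mem_center_of_commute (commute_pow_of_qcomm (X₁_mul_X₂ r s) hs2) ?_
  have hp : ((s ^ 2)⁻¹) ^ l = 1 := by rw [inv_pow, hs2, inv_one]
  have := mul_pow_of_two_factors (X₄_mul_X₂ r s) (X₃_mul_X₂ h) (fun e => h.mul_ne_sq (inv_injective e).symm)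
    hl (by rw [hp, inv_pow, hl₁, inv_one])
  rwa [hp, one_smul] at this

theorem X₃_pow_mem_center (h : Params r s) {l : ℕ} (hl₁ : (r * s) ^ l = 1) :
    X₃ r s ^ l ∈ Subalgebra.center ℂ (UPlus r s) := by
  refine mem_center_of_commute (commute_pow_of_qcomm (X₁_mul_X₃ h) ?_) ?_
  · rw [← mul_pow, ← pow_mul, mul_comm 2, pow_mul, hl₁, one_pow]
  · refine commute_pow_of_qcomm (q := (r * s)⁻¹) ?_ (by rw [inv_pow, hl₁, inv_one])
    rw [X₃_mul_X₄ h, smul_smul, inv_mul_cancel₀ (mul_ne_zero h.r_ne h.s_ne), one_smul]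

/-- Up to a scalar, `X₁` commutes with those powers of `X₄` whose exponents are multiples of the
order of `rs⁻¹`. -/
theorem X₁_mul_X₄_pow (h : Params r s) {n : ℕ} (hn : 2 ≤ n) (hp : (r * s⁻¹) ^ n = 1) :
    X₁ r s * X₄ r s ^ n = (r ^ 2) ^ n • (X₄ r s ^ n * X₁ r s) := by
  have hs := h.s_ne
  have h1 : (r ^ 2) ^ n = (r * s) ^ n * (r * s⁻¹) ^ n := by
    rw [← mul_pow]; congr 1; field_simp
  have h2 : (r * s) ^ n = (s ^ 2) ^ n * (r * s⁻¹) ^ n := by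
    rw [← mul_pow]; congr 1; field_simp
  rw [hp, mul_one] at h1 h2
  refine mul_pow_of_three_factors (q := r * s) (m := s ^ 2) ?_ h.sq_ne_mul
    h.sq_ne h.mul_ne_sq hn h1 (h1.trans h2)
  have e : r ^ 2 * (r * s) + r ^ 2 * s ^ 2 + r * s * s ^ 2 = r * s * (r ^ 2 + r * s + s ^ 2) := by
    ring
  have e' : r ^ 2 * (r * s) * s ^ 2 = r ^ 3 * s ^ 3 := by ring
  rw [e, e']
  exact serre_two r s

theorem X₂_mul_X₄_pow (h : Params r s) {n : ℕ} (hn : 0 < n) (hp : (r * s⁻¹) ^ n = 1) :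
    X₂ r s * X₄ r s ^ n = (s ^ 2) ^ n • (X₄ r s ^ n * X₂ r s) := by
  have hs := h.s_ne
  have h2 : (r * s) ^ n = (s ^ 2) ^ n * (r * s⁻¹) ^ n := by
    rw [← mul_pow]; congr 1; field_simp
  rw [hp, mul_one] at h2
  refine mul_pow_of_two_factors (w := -(s ^ 2 • X₃ r s)) (by rw [X₂_mul_X₄ h]; abel) ?_
    h.mul_ne_sq.symm hn h2.symm
  rw [neg_mul, smul_mul_assoc, X₃_mul_X₄ h, mul_neg, mul_smul_comm, smul_neg, smul_comm]

theorem Params.two_le_of_pow_eq_one (h : Params r s) {n : ℕ} (hn : 0 < n)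
    (hp : (r * s⁻¹) ^ n = 1) : 2 ≤ n := by
  by_contra hc
  obtain rfl : n = 1 := by omega
  rw [pow_one, ← div_eq_mul_inv, div_eq_one_iff_eq h.s_ne] at hp
  exact h.sq_ne (by rw [hp])

theorem X₄_pow_mem_center (h : Params r s) {l : ℕ} (hl : 0 < l) (hl₁ : (r * s) ^ l = 1)
    (hl₂ : (r * s⁻¹) ^ l = 1) : X₄ r s ^ l ∈ Subalgebra.center ℂ (UPlus r s) := by
  obtain ⟨hr2, -⟩ := sq_pow_eq_one h hl₁ hl₂
  refine mem_center_of_commute ?_ ((Commute.refl _).pow_right l)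
  have := X₁_mul_X₄_pow h (h.two_le_of_pow_eq_one hl hl₂) hl₂
  rwa [hr2, one_smul] at this

/-- Up to a scalar, `X₁` commutes with those powers of `z` whose exponents are multiples of the
order of `r⁻²s²`. -/
theorem X₁_mul_zElt_pow (h : Params r s) {m : ℕ} (hm : 0 < m) (hq : (r ^ 2) ^ m = (s ^ 2) ^ m) :
    X₁ r s * zElt r s ^ m = (r ^ 2 * s ^ 2) ^ m • (zElt r s ^ m * X₁ r s) := by
  have h2 : X₂ r s ^ 2 * zElt r s = s ^ 4 • (zElt r s * X₂ r s ^ 2) := by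
    rw [pow_two, mul_assoc, X₂_mul_zElt h, mul_smul_comm, ← mul_assoc, X₂_mul_zElt h,
      smul_mul_assoc, mul_assoc, smul_smul]
    congr 1
    ring
  refine mul_pow_of_two_factors (q := s ^ 4) (X₁_mul_zElt h)
    (by rw [smul_mul_assoc, h2, mul_smul_comm, smul_comm]) (fun e => ?_) hm
    (by rw [mul_pow, hq, ← mul_pow, ← pow_add])
  have hs : s ^ 2 ≠ 0 := pow_ne_zero 2 h.s_ne
  exact h.sq_ne (mul_right_cancel₀ hs (by rw [e]; ring))

theorem zElt_pow_mem_center (h : Params r s) {l : ℕ} (hl : 0 < l) (hl₁ : (r * s) ^ l = 1)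
    (hl₂ : (r * s⁻¹) ^ l = 1) : zElt r s ^ l ∈ Subalgebra.center ℂ (UPlus r s) := by
  obtain ⟨hr2, hs2⟩ := sq_pow_eq_one h hl₁ hl₂
  refine mem_center_of_commute ?_ ?_
  · have := X₁_mul_zElt_pow h hl (hr2.trans hs2.symm)
    rwa [mul_pow, hr2, hs2, one_mul, one_smul] at this
  · refine commute_pow_of_qcomm (q := (s ^ 2)⁻¹) ?_ (by rw [inv_pow, hs2, inv_one])
    rw [zElt_mul_X₄ h, smul_smul, inv_mul_cancel₀ (pow_ne_zero 2 h.s_ne), one_smul]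

end Algebra

/-! ### Joint eigenvectors of linear operators -/

section LinearAlgebra

open Polynomial

variable {V : Type*} [AddCommGroup V] [Module ℂ V]

theorem exists_eigenvector_of_aeval_eq_zero (T : Module.End ℂ V) (W : Submodule ℂ V)
    (hT : ∀ w ∈ W, T w ∈ W) {p : ℂ[X]} (hp : p ≠ 0) {w : V} (hw : w ∈ W) (hw0 : w ≠ 0)
    (h : aeval T p w = 0) : ∃ v ∈ W, v ≠ 0 ∧ ∃ c : ℂ, T v = c • v := by
  induction hn : p.natDegree generalizing p w with
  | zero =>
    rw [eq_C_of_natDegree_eq_zero hn] at h hp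
    rw [aeval_C, Module.algebraMap_end_apply] at h
    exact absurd ((smul_eq_zero.1 h).resolve_left fun e => hp (by rw [e, C_0])) hw0
  | succ n ih =>
    have hd : p.degree ≠ 0 := fun e => by simp [natDegree_eq_of_degree_eq_some e] at hn
    obtain ⟨c, hc⟩ := IsAlgClosed.exists_root p hd
    obtain ⟨q, rfl⟩ := dvd_iff_isRoot.2 hc
    by_cases hu : T w - c • w = 0
    · exact ⟨w, hw, hw0, c, sub_eq_zero.1 hu⟩
    · have hq : q ≠ 0 := right_ne_zero_of_mul hp
      refine ih hq (W.sub_mem (hT w hw) (W.smul_mem c hw)) hu ?_ ?_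
      · rw [mul_comm, map_mul, Module.End.mul_apply] at h
        simpa [Module.algebraMap_end_apply] using h
      · rw [natDegree_mul (X_sub_C_ne_zero c) hq, natDegree_X_sub_C] at hn
        omega

theorem exists_eigenvector_of_pow (T : Module.End ℂ V) (W : Submodule ℂ V)
    (hT : ∀ w ∈ W, T w ∈ W) {n : ℕ} (hn : 0 < n) {c : ℂ} {w : V} (hw : w ∈ W) (hw0 : w ≠ 0)
    (h : (T ^ n) w = c • w) : ∃ v ∈ W, v ≠ 0 ∧ ∃ μ : ℂ, T v = μ • v :=
  exists_eigenvector_of_aeval_eq_zero T W hT (X_pow_sub_C_ne_zero hn c) hw hw0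
    (by simp [h, Module.algebraMap_end_apply])

theorem pow_apply_of_eigenvector {T : Module.End ℂ V} {v : V} {c : ℂ} (h : T v = c • v) (n : ℕ) :
    (T ^ n) v = c ^ n • v := by
  induction n with
  | zero => simp
  | succ n ih => rw [pow_succ, Module.End.mul_apply, h, map_smul, ih, smul_smul, pow_succ']

theorem linearIndependent_of_joint_eigenvectors {ι κ : Type*} (T : κ → Module.End ℂ V)
    (χ : ι → κ → ℂ) (hχ : Function.Injective χ) (w : ι → V) (hw : ∀ i, w i ≠ 0)
    (h : ∀ i k, T k (w i) = χ i k • w i) : LinearIndependent ℂ w := by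
  classical
  rw [linearIndependent_iff']
  intro t
  induction t using Finset.induction_on with
  | empty => simp
  | insert j t hj ih =>
    intro g hg
    rw [Finset.sum_insert hj] at hg
    have key : ∀ i ∈ t, g i = 0 := by
      intro i hi
      obtain ⟨k, hk⟩ := Function.ne_iff.1 (hχ.ne fun e => hj (e ▸ hi) : χ i ≠ χ j)
      -- applying `T k - χ j k` removes the summand of index `j`
      have h1 : ∑ i ∈ t, (g i * (χ i k - χ j k)) • w i = 0 := by
        have h2 := congrArg (fun v => T k v - χ j k • v) hg
        simp only [map_add, map_sum, map_smul, h, smul_add, Finset.smul_sum, map_zero,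
          smul_zero, sub_zero] at h2
        rw [smul_comm, add_sub_add_left_eq_sub, ← Finset.sum_sub_distrib] at h2
        rw [← h2]
        refine Finset.sum_congr rfl fun i _ => ?_
        module
      exact (mul_eq_zero.1 (ih _ h1 i hi)).resolve_right (sub_ne_zero.2 hk)
    intro i hi
    rcases Finset.mem_insert.1 hi with rfl | hi
    · rw [Finset.sum_eq_zero (fun i hi => by rw [key i hi, zero_smul]), add_zero] at hg
      exact (smul_eq_zero.1 hg).resolve_right (hw _)
    · exact key i hi

theorem exists_ne_zero_ker_of_pow_eq_zero (T : Module.End ℂ V) (W : Submodule ℂ V)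
    (hT : ∀ w ∈ W, T w ∈ W) {n : ℕ} {w : V} (hw : w ∈ W) (hw0 : w ≠ 0) (h : (T ^ n) w = 0) :
    ∃ v ∈ W, v ≠ 0 ∧ T v = 0 := by
  induction n generalizing w with
  | zero => exact absurd (by simpa using h) hw0
  | succ n ih =>
    by_cases hz : T w = 0
    · exact ⟨w, hw, hw0, hz⟩
    · exact ih (hT w hw) hz (by rwa [pow_succ, Module.End.mul_apply] at h)

end LinearAlgebra

/-! ### Simple right modules and Schur's lemma -/

section Modules

variable {r s : ℂ} {N : Type*} [AddCommGroup N] [Module ℂ N] [Module (UPlus r s)ᵐᵒᵖ N]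
  [IsScalarTower ℂ (UPlus r s)ᵐᵒᵖ N]

/-- The operator `v ↦ v · x` on a right module. -/
noncomputable def act (N : Type*) [AddCommGroup N] [Module ℂ N] [Module (UPlus r s)ᵐᵒᵖ N]
    [IsScalarTower ℂ (UPlus r s)ᵐᵒᵖ N] (x : UPlus r s) : Module.End ℂ N :=
  Algebra.lsmul ℂ ℂ N (MulOpposite.op x)

theorem act_apply (x : UPlus r s) (v : N) : act N x v = MulOpposite.op x • v := rfl

theorem act_mul (x y : UPlus r s) : act N (x * y) = act N y * act N x := by
  rw [act, MulOpposite.op_mul, map_mul]; rfl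

theorem act_mul_apply (x y : UPlus r s) (v : N) : act N (x * y) v = act N y (act N x v) := by
  rw [act_mul, Module.End.mul_apply]

theorem act_pow (x : UPlus r s) (n : ℕ) : act N (x ^ n) = act N x ^ n := by
  rw [act, MulOpposite.op_pow, map_pow]; rfl

theorem act_add (x y : UPlus r s) : act N (x + y) = act N x + act N y := by
  rw [act, MulOpposite.op_add, map_add]; rfl

theorem act_sub (x y : UPlus r s) : act N (x - y) = act N x - act N y := by
  rw [act, MulOpposite.op_sub, map_sub]; rfl

theorem act_smul (c : ℂ) (x : UPlus r s) : act N (c • x) = c • act N x := by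
  rw [act, MulOpposite.op_smul, map_smul]; rfl

theorem act_algebraMap (c : ℂ) (v : N) : act N (algebraMap ℂ (UPlus r s) c) v = c • v := by
  rw [Algebra.algebraMap_eq_smul_one, act_smul, LinearMap.smul_apply, act_apply, MulOpposite.op_one,
    one_smul]

/-- A relation `x y = q y x` in the algebra, read on a module. -/
theorem act_act_of_qcomm {x y : UPlus r s} {q : ℂ} (h : x * y = q • (y * x)) (v : N) :
    act N y (act N x v) = q • act N x (act N y v) := by
  rw [← act_mul_apply, h, act_smul, LinearMap.smul_apply, act_mul_apply]

theorem mem_of_stable {W : Submodule ℂ N} (h₁ : ∀ w ∈ W, act N (X₁ r s) w ∈ W)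
    (h₄ : ∀ w ∈ W, act N (X₄ r s) w ∈ W) (x : UPlus r s) : ∀ w ∈ W, act N x w ∈ W := by
  have hx : x ∈ Algebra.adjoin ℂ {X₁ r s, X₄ r s} := by rw [adjoin_X]; trivial
  induction hx using Algebra.adjoin_induction with
  | mem x hx =>
    rcases hx with rfl | rfl
    · exact h₁
    · exact h₄
  | algebraMap c => exact fun w hw => by rw [act_algebraMap]; exact W.smul_mem c hw
  | add x y _ _ hx hy => exact fun w hw => by rw [act_add]; exact W.add_mem (hx w hw) (hy w hw)
  | mul x y _ _ hx hy => exact fun w hw => by rw [act_mul_apply]; exact hy _ (hx w hw)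

theorem eq_top_of_stable [IsSimpleModule (UPlus r s)ᵐᵒᵖ N] {W : Submodule ℂ N}
    (h₁ : ∀ w ∈ W, act N (X₁ r s) w ∈ W) (h₄ : ∀ w ∈ W, act N (X₄ r s) w ∈ W) {v : N}
    (hv : v ∈ W) (hv0 : v ≠ 0) : W = ⊤ := by
  let W' : Submodule (UPlus r s)ᵐᵒᵖ N :=
    { carrier := W
      add_mem' := W.add_mem
      zero_mem' := W.zero_mem
      smul_mem' := fun x w hw => mem_of_stable h₁ h₄ x.unop w hw }
  have hW' : W' = ⊤ := (eq_bot_or_eq_top W').resolve_left fun e => hv0 (by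
    have : v ∈ W' := hv
    rwa [e, Submodule.mem_bot] at this)
  rw [eq_top_iff]
  intro w _
  have : w ∈ W' := by rw [hW']; trivial
  exact this

theorem map_act_of_generators {M : Type*} [AddCommGroup M] [Module ℂ M] [Module (UPlus r s)ᵐᵒᵖ M]
    [IsScalarTower ℂ (UPlus r s)ᵐᵒᵖ M] {φ : M →ₗ[ℂ] N}
    (h₁ : ∀ w, φ (act M (X₁ r s) w) = act N (X₁ r s) (φ w))
    (h₄ : ∀ w, φ (act M (X₄ r s) w) = act N (X₄ r s) (φ w)) (x : UPlus r s) :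
    ∀ w, φ (act M x w) = act N x (φ w) := by
  have hx : x ∈ Algebra.adjoin ℂ {X₁ r s, X₄ r s} := by rw [adjoin_X]; trivial
  induction hx using Algebra.adjoin_induction with
  | mem x hx =>
    rcases hx with rfl | rfl
    · exact h₁
    · exact h₄
  | algebraMap c => exact fun w => by rw [act_algebraMap, act_algebraMap, map_smul]
  | add x y _ _ hx hy =>
    intro w
    rw [act_add, act_add, LinearMap.add_apply, LinearMap.add_apply, map_add, hx, hy]
  | mul x y _ _ hx hy => exact fun w => by rw [act_mul_apply, act_mul_apply, hy, hx]

theorem nonempty_equiv_of_injective [IsSimpleModule (UPlus r s)ᵐᵒᵖ N] {M : Type*} [AddCommGroup M]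
    [Module ℂ M] [Module (UPlus r s)ᵐᵒᵖ M] [IsScalarTower ℂ (UPlus r s)ᵐᵒᵖ M] [Nontrivial M]
    {φ : M →ₗ[ℂ] N} (hφ : Function.Injective φ)
    (h₁ : ∀ w, φ (act M (X₁ r s) w) = act N (X₁ r s) (φ w))
    (h₄ : ∀ w, φ (act M (X₄ r s) w) = act N (X₄ r s) (φ w)) :
    Nonempty (N ≃ₗ[(UPlus r s)ᵐᵒᵖ] M) := by
  obtain ⟨m, hm⟩ := exists_ne (0 : M)
  have htop : LinearMap.range φ = ⊤ := by
    refine eq_top_of_stable (r := r) (s := s) ?_ ?_ (LinearMap.mem_range_self φ m) ((map_ne_zero_iff φ hφ).2 hm)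
    · rintro _ ⟨w, rfl⟩
      exact ⟨_, h₁ w⟩
    · rintro _ ⟨w, rfl⟩
      exact ⟨_, h₄ w⟩
  let ψ : M →ₗ[(UPlus r s)ᵐᵒᵖ] N :=
    { toFun := φ
      map_add' := map_add φ
      map_smul' := fun x w => map_act_of_generators h₁ h₄ x.unop w }
  exact ⟨(LinearEquiv.ofBijective ψ ⟨hφ, (LinearMap.range_eq_top (f := φ)).1 htop⟩).symm⟩

theorem rank_UPlus_le (r s : ℂ) : Module.rank ℂ (UPlus r s) ≤ Cardinal.aleph0 := by
  have h := Algebra.rank_adjoin_le (R := ℂ) {X₁ r s, X₄ r s}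
  rw [adjoin_X, Subalgebra.topEquiv.toLinearEquiv.rank_eq] at h
  exact h.trans (max_le (Set.toFinite _).lt_aleph0.le le_rfl)

/-- **Schur's lemma**: since the algebra has countable dimension over the uncountable algebraically
closed field `ℂ`, its center acts on simple modules by scalars. -/
theorem exists_act_eq_smul_of_mem_center [IsSimpleModule (UPlus r s)ᵐᵒᵖ N] {z : UPlus r s}
    (hz : z ∈ Subalgebra.center ℂ (UPlus r s)) : ∃ c : ℂ, ∀ v : N, act N z v = c • v := by
  by_contra! hne
  have := IsSimpleModule.nontrivial (UPlus r s)ᵐᵒᵖ N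
  obtain ⟨v, hv⟩ := exists_ne (0 : N)
  have hbij : ∀ c : ℂ, Function.Bijective (act N z - c • (1 : Module.End ℂ N)) := by
    intro c
    let f : N →ₗ[(UPlus r s)ᵐᵒᵖ] N :=
      { toFun := act N z - c • (1 : Module.End ℂ N)
        map_add' := fun x y => map_add (act N z - c • (1 : Module.End ℂ N)) x y
        map_smul' := fun x w => by
          change act N z (act N x.unop w) - c • act N x.unop w
            = act N x.unop (act N z w - c • w)
          rw [map_sub, map_smul, ← act_mul_apply, ← act_mul_apply,
            Subalgebra.mem_center_iff.1 hz] }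
    refine (LinearMap.bijective_or_eq_zero f).resolve_right fun h0 => ?_
    obtain ⟨w, hw⟩ := hne c
    exact hw (sub_eq_zero.1 (LinearMap.congr_fun h0 w))
  have hnoeig : ∀ w : N, w ≠ 0 → ∀ c : ℂ, act N z w ≠ c • w := fun w hw c e =>
    hw ((hbij c).1 (by simp [e]))
  choose u hu using fun c => (hbij c).2 v
  replace hu : ∀ c, act N z (u c) = c • u c + v := fun c => by
    rw [← sub_eq_iff_eq_add']; exact hu c
  -- modulo `ℂ[z] v`, the vector `(z - c)⁻¹ v` is an eigenvector of `z` for the eigenvalue `c`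
  let ev : Polynomial ℂ →ₗ[ℂ] N :=
    (LinearMap.applyₗ v) ∘ₗ (Polynomial.aeval (act N z)).toLinearMap
  have hev : ∀ p, ev p = Polynomial.aeval (act N z) p v := fun p => rfl
  let W := LinearMap.range ev
  have hvW : v ∈ W := ⟨1, by simp [hev]⟩
  have hW : W ≤ W.comap (act N z) := by
    rintro _ ⟨p, rfl⟩
    exact ⟨Polynomial.X * p, by simp [hev]⟩
  have huW : ∀ c, u c ∉ W := by
    rintro c ⟨p, hp⟩
    rw [hev] at hp
    have h0 : Polynomial.aeval (act N z) ((Polynomial.X - Polynomial.C c) * p - 1) v = 0 := by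
      simp [hp, hu, Module.algebraMap_end_apply]
    have hp0 : (Polynomial.X - Polynomial.C c) * p - 1 ≠ 0 := fun e => by
      simpa using congrArg (Polynomial.eval c) e
    obtain ⟨w, -, hw, d, hd⟩ := exists_eigenvector_of_aeval_eq_zero (act N z) ⊤
      (fun _ _ => trivial) hp0 (Submodule.mem_top : v ∈ ⊤) hv h0
    exact hnoeig w hw d hd
  have hli : LinearIndependent ℂ fun c => W.mkQ (u c) := by
    refine Module.End.eigenvectors_linearIndependent' (W.mapQ W (act N z) hW) id
      Function.injective_id _ fun c => ?_
    rw [Module.End.hasEigenvector_iff, Module.End.mem_eigenspace_iff]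
    refine ⟨?_, fun e => huW c ((Submodule.Quotient.mk_eq_zero W).1 e)⟩
    rw [Submodule.mkQ_apply, Submodule.mapQ_apply, hu, Submodule.Quotient.mk_add,
      (Submodule.Quotient.mk_eq_zero W).2 hvW, add_zero]
    rfl
  have hli' : LinearIndependent ℂ u := hli.of_comp W.mkQ
  choose g hg using fun c => IsSimpleModule.toSpanSingleton_surjective (UPlus r s)ᵐᵒᵖ hv (u c)
  let f : UPlus r s →ₗ[ℂ] N :=
    { toFun := fun x => act N x v
      map_add' := fun x y => by rw [act_add]; rfl
      map_smul' := fun c x => by rw [act_smul]; rfl }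
  have hfg : f ∘ (fun c => (g c).unop) = u := funext hg
  have hU : LinearIndependent ℂ fun c => (g c).unop := by
    rw [← hfg] at hli'
    exact hli'.of_comp f
  have := hU.cardinal_le_rank.trans (rank_UPlus_le r s)
  rw [Cardinal.mk_complex] at this
  exact absurd this (not_le.2 Cardinal.aleph0_lt_continuum)

end Modules

/-- The scalars of the algebra act on the module defined by four operators as they should. -/
theorem IsAction.isScalarTower {r s : ℂ} {V : Type*} [AddCommGroup V] [Module ℂ V]
    {A₁ A₂ A₃ A₄ : Module.End ℂ V} (h : IsAction r s A₁ A₂ A₃ A₄) :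
    letI := h.module
    IsScalarTower ℂ (UPlus r s)ᵐᵒᵖ V := by
  let _ := h.module
  refine ⟨fun c x v => ?_⟩
  change (AlgHom.opComm h.hom : (UPlus r s)ᵐᵒᵖ →ₐ[ℂ] Module.End ℂ V) (c • x) v
    = c • (AlgHom.opComm h.hom : (UPlus r s)ᵐᵒᵖ →ₐ[ℂ] Module.End ℂ V) x v
  rw [map_smul, LinearMap.smul_apply]

instance {r s : ℂ} (h : Params r s) (ν₁ ν₂ : ℂˣ) (ν₃ : ℂ) :
    IsScalarTower ℂ (UPlus r s)ᵐᵒᵖ (MNu h ν₁ ν₂ ν₃) :=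
  (nu_isAction h ν₁ ν₂ ν₃).isScalarTower

instance {r s : ℂ} (h : Params r s) (ξ₁ : ℂˣ) (ξ₂ : ℂ) :
    IsScalarTower ℂ (UPlus r s)ᵐᵒᵖ (MXi h ξ₁ ξ₂) :=
  (xi_isAction h ξ₁ ξ₂).isScalarTower

/-! ### The modules `M(ξ)` -/

section Xi

variable {r s : ℂ}

/-- If a linear map intertwines the fourth operators of two actions, then the set of vectors on
which it intertwines the other three is stable under the fourth operator. -/
theorem IsAction.intertwine_step {V V' : Type*} [AddCommGroup V] [Module ℂ V] [AddCommGroup V']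
    [Module ℂ V'] {A₁ A₂ A₃ A₄ : Module.End ℂ V} {B₁ B₂ B₃ B₄ : Module.End ℂ V'}
    (h : Params r s) (hA : IsAction r s A₁ A₂ A₃ A₄) (hB : IsAction r s B₁ B₂ B₃ B₄)
    {φ : V →ₗ[ℂ] V'} (h₄ : ∀ w, φ (A₄ w) = B₄ (φ w)) {w : V} (h₁ : φ (A₁ w) = B₁ (φ w))
    (h₂ : φ (A₂ w) = B₂ (φ w)) (h₃ : φ (A₃ w) = B₃ (φ w)) :
    φ (A₁ (A₄ w)) = B₁ (φ (A₄ w)) ∧ φ (A₂ (A₄ w)) = B₂ (φ (A₄ w)) ∧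
      φ (A₃ (A₄ w)) = B₃ (φ (A₄ w)) := by
  refine ⟨?_, ?_, ?_⟩
  · refine smul_right_injective V' (pow_ne_zero 2 h.r_ne) ?_
    change r ^ 2 • _ = r ^ 2 • _
    have e := hA.r14 w
    have e' := hB.r14 (φ w)
    rw [← sub_eq_iff_eq_add] at e e'
    rw [← map_smul, ← e, map_sub, h₄, h₁, h₂, e', h₄]
  · refine smul_right_injective V' (pow_ne_zero 2 h.s_ne) ?_
    change s ^ 2 • _ = s ^ 2 • _
    have e := hA.r24 w
    have e' := hB.r24 (φ w)
    rw [eq_sub_iff_add_eq] at e e'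
    rw [← map_smul, ← e, map_add, map_smul, h₄, h₃, h₂, e', h₄]
  · refine smul_right_injective V' (mul_ne_zero h.r_ne h.s_ne) ?_
    change (r * s) • _ = (r * s) • _
    rw [← map_smul, ← hA.r34, h₄, h₃, hB.r34, h₄]

theorem act_isAction (h : Params r s) (N : Type*) [AddCommGroup N] [Module ℂ N]
    [Module (UPlus r s)ᵐᵒᵖ N] [IsScalarTower ℂ (UPlus r s)ᵐᵒᵖ N] :
    IsAction r s (act N (X₁ r s)) (act N (X₂ r s)) (act N (X₃ r s)) (act N (X₄ r s)) where
  r12 := act_act_of_qcomm (X₁_mul_X₂ r s)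
  r14 v := by
    rw [← act_mul_apply, X₁_mul_X₄, act_add, act_smul, act_mul]; rfl
  r24 v := by
    rw [← act_mul_apply, X₂_mul_X₄ h, act_sub, act_smul, act_smul, act_mul]; rfl
  r34 := act_act_of_qcomm (X₃_mul_X₄ h)

theorem act_MXi (h : Params r s) (ξ₁ : ℂˣ) (ξ₂ : ℂ) (v : MXi h ξ₁ ξ₂) :
    act (MXi h ξ₁ ξ₂) (X₁ r s) v = xiX₁ r s ξ₁ ξ₂ v ∧
    act (MXi h ξ₁ ξ₂) (X₄ r s) v = xiX₄ r s ξ₂ v :=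
  ⟨(MXi.smul_X h ξ₁ ξ₂ v).1, (MXi.smul_X h ξ₁ ξ₂ v).2.2.2⟩

theorem orderOf_dvd_sub_of_pow_eq {x : ℂ} (hx : x ≠ 0) {a b : ℕ} (hab : a ≤ b)
    (h : x ^ a = x ^ b) : orderOf x ∣ b - a := by
  refine orderOf_dvd_of_pow_eq_one (mul_left_cancel₀ (pow_ne_zero a hx) ?_)
  rw [← pow_add, Nat.add_sub_cancel' hab, h, mul_one]

variable {N : Type*} [AddCommGroup N] [Module ℂ N] [Module (UPlus r s)ᵐᵒᵖ N]
  [IsScalarTower ℂ (UPlus r s)ᵐᵒᵖ N]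

/-- A simple module with a vector `v` that has the properties of `e(0)` is `M(ξ)`, through
`e(a) ↦ v X₄ᵃ`. -/
theorem nonempty_equiv_MXi (h : Params r s) [IsSimpleModule (UPlus r s)ᵐᵒᵖ N] (ξ₁ : ℂˣ) (ξ₂ : ℂ)
    {v : N} (hv : v ≠ 0) (h₁ : act N (X₁ r s) v = 0) (h₂ : act N (X₂ r s) v = 0)
    (h₃ : act N (X₃ r s) v = (ξ₁ : ℂ) • v)
    (h₄ : (act N (X₄ r s) ^ ell₄ r s ξ₂) v = ξ₂ • v) :
    Nonempty (N ≃ₗ[(UPlus r s)ᵐᵒᵖ] MXi h ξ₁ ξ₂) := by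
  have hr := h.r_ne
  have hs := h.s_ne
  have hξ := ξ₁.ne_zero
  have hm := ell₄_pos h ξ₂
  have hN := act_isAction h N
  have hM := xi_isAction h ξ₁ ξ₂
  set A := act N (X₄ r s) with hA
  let w : Fin (ell₄ r s ξ₂) → N := fun a => (A ^ (a : ℕ)) v
  let φ : VXi r s ξ₂ →ₗ[ℂ] N := Finsupp.linearCombination ℂ w
  have hφ : ∀ a, a < ell₄ r s ξ₂ → φ (eXi r s ξ₂ a) = (A ^ a) v := fun a ha => by
    rw [eXi, dif_pos ha]
    exact (Finsupp.linearCombination_single ℂ _ _).trans (one_smul ℂ _)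
  have hφ' : ∀ a, a ≤ ell₄ r s ξ₂ → φ (eXi' r s ξ₂ a) = (A ^ a) v := fun a ha => by
    unfold eXi'
    split_ifs with hc
    · rw [map_smul, hφ 0 hm, hc, h₄, pow_zero, Module.End.one_apply]
    · exact hφ a (by omega)
  have i4 : ∀ u, φ (xiX₄ r s ξ₂ u) = A (φ u) := by
    refine LinearMap.congr_fun (f := φ ∘ₗ xiX₄ r s ξ₂) (g := A ∘ₗ φ) (ext_xi fun a ha => ?_)
    rw [LinearMap.comp_apply, LinearMap.comp_apply, xiX₄_apply _ _ _ ha, hφ' _ ha, hφ _ ha,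
      pow_succ', Module.End.mul_apply]
  have i123 : ∀ a, a < ell₄ r s ξ₂ →
      φ (xiX₁ r s ξ₁ ξ₂ (eXi r s ξ₂ a)) = act N (X₁ r s) (φ (eXi r s ξ₂ a)) ∧
      φ (xiX₂ r s ξ₁ ξ₂ (eXi r s ξ₂ a)) = act N (X₂ r s) (φ (eXi r s ξ₂ a)) ∧
      φ (xiX₃ r s ξ₁ ξ₂ (eXi r s ξ₂ a)) = act N (X₃ r s) (φ (eXi r s ξ₂ a)) := by
    intro a
    induction a with
    | zero =>
      intro ha
      rw [xiX₁_zero, xiX₂_zero, xiX₃_apply _ _ _ _ ha, map_smul, map_zero, hφ 0 ha, pow_zero,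
        pow_zero, Module.End.one_apply, h₁, h₂, h₃, inv_one, one_mul]
      exact ⟨rfl, rfl, rfl⟩
    | succ a ih =>
      intro ha
      obtain ⟨j1, j2, j3⟩ := ih (by omega)
      have e : eXi r s ξ₂ (a + 1) = xiX₄ r s ξ₂ (eXi r s ξ₂ a) := by
        rw [xiX₄_apply _ _ _ (by omega), eXi', if_neg ha.ne]
      rw [e]
      exact hM.intertwine_step h hN i4 j1 j2 j3
  have i1 : ∀ u, φ (xiX₁ r s ξ₁ ξ₂ u) = act N (X₁ r s) (φ u) :=
    LinearMap.congr_fun (f := φ ∘ₗ xiX₁ r s ξ₁ ξ₂) (g := act N (X₁ r s) ∘ₗ φ)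
      (ext_xi fun a ha => (i123 a ha).1)
  have hE : (1 : ℂ) - r * s⁻¹ ≠ 0 := fun e => h.sub_ne (by field_simp at e; linear_combination -e)
  have hne : ∀ a, a < ell₄ r s ξ₂ → (A ^ a) v ≠ 0 := by
    by_cases h0 : ξ₂ = 0
    · -- here `ℓ₄` is the order of `rs⁻¹`, so `X₂` maps `v X₄ᵃ⁺¹` to a non-zero multiple of `v X₄ᵃ`
      intro a
      induction a with
      | zero => intro _; simpa using hv
      | succ a ih =>
        intro ha hz
        have e := (i123 (a + 1) ha).2.1
        rw [xiX₂_succ _ _ _ _ ha, map_smul, hφ _ (by omega), hφ _ ha, hz, map_zero] at e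
        refine (smul_ne_zero ?_ (ih (by omega))) e
        refine mul_ne_zero (mul_ne_zero (inv_ne_zero (pow_ne_zero _ (mul_ne_zero hr hs)))
          (div_ne_zero (fun e1 => ?_) hE)) hξ
        have := orderOf_le_of_pow_eq_one (Nat.succ_pos a) (sub_eq_zero.1 e1).symm
        rw [ell₄, if_neg (not_not.2 h0)] at ha
        omega
    · intro a ha hz
      refine smul_ne_zero h0 hv ?_
      rw [← h₄, ← Nat.sub_add_cancel ha.le, pow_add, Module.End.mul_apply, hz, map_zero]
  have hinj : Function.Injective φ := by
    refine linearIndependent_of_joint_eigenvectors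
      (fun k : Bool => if k then act N (X₃ r s) else A * act N (X₂ r s))
      (fun (a : Fin (ell₄ r s ξ₂)) (k : Bool) => if k then ((r * s) ^ (a : ℕ))⁻¹ * (ξ₁ : ℂ) else
        (r * s) * ((r * s) ^ (a : ℕ))⁻¹ * ((1 - (r * s⁻¹) ^ (a : ℕ)) / (1 - r * s⁻¹)) * (ξ₁ : ℂ))
      ?_ w (fun a => hne a a.2) ?_
    · have key : ∀ a b : ℕ, a ≤ b → b < ell₄ r s ξ₂ → (r * s) ^ a = (r * s) ^ b →
          (r * s⁻¹) ^ a = (r * s⁻¹) ^ b → a = b := by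
        intro a b hab hb e1 e2
        have d1 := orderOf_dvd_sub_of_pow_eq (mul_ne_zero hr hs) hab e1
        have d2 := orderOf_dvd_sub_of_pow_eq (mul_ne_zero hr (inv_ne_zero hs)) hab e2
        have d : ell₄ r s ξ₂ ∣ b - a := by
          unfold ell₄
          split_ifs
          · exact Nat.lcm_dvd d1 d2
          · exact d2
        have := Nat.eq_zero_of_dvd_of_lt d (by omega)
        omega
      intro a b hab
      have e1 := congrFun hab true
      have e2 := congrFun hab false
      simp only [if_true] at e1
      have e1' := inv_injective (mul_right_cancel₀ hξ e1)
      simp only [Bool.false_eq_true, if_false, e1'] at e2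
      have e2' := mul_left_cancel₀ (mul_ne_zero (mul_ne_zero hr hs)
        (inv_ne_zero (pow_ne_zero _ (mul_ne_zero hr hs)))) (mul_right_cancel₀ hξ e2)
      rw [div_left_inj' hE] at e2'
      have e2'' := sub_right_injective e2'
      rcases le_total (a : ℕ) b with hle | hle
      · exact Fin.ext (key _ _ hle b.2 e1' e2'')
      · exact Fin.ext (key _ _ hle a.2 e1'.symm e2''.symm).symm
    · rintro ⟨a, ha⟩ (_ | _)
      · simp only [Bool.false_eq_true, if_false, Module.End.mul_apply, w]
        rw [← hφ a ha, ← (i123 a ha).2.1]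
        rcases a with _ | a
        · rw [xiX₂_zero]
          simp
        · rw [xiX₂_succ _ _ _ _ ha, map_smul, map_smul, hφ _ ha, hφ _ (by omega), pow_succ' A a,
            Module.End.mul_apply, pow_succ' (r * s) a]
          congr 1
          field_simp
      · simp only [if_true, w]
        rw [← hφ a ha, ← (i123 a ha).2.2, xiX₃_apply _ _ _ _ ha, map_smul]
  have : Nontrivial (MXi h ξ₁ ξ₂) := by
    have : Nonempty (Fin (ell₄ r s ξ₂)) := ⟨⟨0, hm⟩⟩
    exact inferInstanceAs (Nontrivial (VXi r s ξ₂))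
  refine nonempty_equiv_of_injective (M := MXi h ξ₁ ξ₂) (φ := φ) hinj (fun u => ?_) (fun u => ?_)
  · rw [(act_MXi h ξ₁ ξ₂ u).1]
    exact i1 u
  · rw [(act_MXi h ξ₁ ξ₂ u).2]
    exact i4 u

theorem act_eq_zero_of_qcomm {x y : UPlus r s} {q : ℂ} (hq : q ≠ 0) (h : x * y = q • (y * x))
    {v : N} (hv : act N x v = 0) : act N x (act N y v) = 0 := by
  have := act_act_of_qcomm h v
  rw [hv, map_zero] at this
  exact (smul_eq_zero.1 this.symm).resolve_left hq

/-- The powers of `X₄` applied to a vector like `e(0)` span a submodule. -/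
theorem aeval_X₄_surjective (h : Params r s) [IsSimpleModule (UPlus r s)ᵐᵒᵖ N] {c : ℂ}
    {v : N} (hv : v ≠ 0) (h₁ : act N (X₁ r s) v = 0) (h₂ : act N (X₂ r s) v = 0)
    (h₃ : act N (X₃ r s) v = c • v) (u : N) :
    ∃ p : Polynomial ℂ, Polynomial.aeval (act N (X₄ r s)) p v = u := by
  have hN := act_isAction h N
  set A := act N (X₄ r s) with hA
  let ev : Polynomial ℂ →ₗ[ℂ] N := (LinearMap.applyₗ v) ∘ₗ (Polynomial.aeval A).toLinearMap
  have hev : ∀ p, ev p = Polynomial.aeval A p v := fun p => rfl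
  let W := LinearMap.range ev
  have hvW : v ∈ W := ⟨1, by simp [hev]⟩
  have hA4 : ∀ w ∈ W, A w ∈ W := by
    rintro _ ⟨p, rfl⟩
    exact ⟨Polynomial.X * p, by simp [hev]⟩
  have hpow : ∀ n : ℕ, act N (X₁ r s) ((A ^ n) v) ∈ W ∧ act N (X₂ r s) ((A ^ n) v) ∈ W ∧
      act N (X₃ r s) ((A ^ n) v) ∈ W := by
    intro n
    induction n with
    | zero =>
      rw [pow_zero, Module.End.one_apply, h₁, h₂, h₃]
      exact ⟨W.zero_mem, W.zero_mem, W.smul_mem c hvW⟩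
    | succ n ih =>
      obtain ⟨j1, j2, j3⟩ := ih
      rw [pow_succ', Module.End.mul_apply]
      have e1 := hN.r14 ((A ^ n) v)
      have e2 := hN.r24 ((A ^ n) v)
      have e3 := hN.r34 ((A ^ n) v)
      rw [← sub_eq_iff_eq_add] at e1
      rw [eq_sub_iff_add_eq] at e2
      refine ⟨(W.smul_mem_iff (pow_ne_zero 2 h.r_ne)).1 ?_,
        (W.smul_mem_iff (pow_ne_zero 2 h.s_ne)).1 ?_,
        (W.smul_mem_iff (mul_ne_zero h.r_ne h.s_ne)).1 ?_⟩
      · rw [← e1]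
        exact W.sub_mem (hA4 _ j1) j2
      · rw [← e2]
        exact W.add_mem (hA4 _ j2) (W.smul_mem _ j3)
      · rw [← e3]
        exact hA4 _ j3
  have hA1 : ∀ w ∈ W, act N (X₁ r s) w ∈ W := by
    rintro _ ⟨p, rfl⟩
    rw [hev, Polynomial.aeval_eq_sum_range, LinearMap.sum_apply, map_sum]
    refine W.sum_mem fun n _ => ?_
    rw [LinearMap.smul_apply, map_smul]
    exact W.smul_mem _ (hpow n).1
  have htop := eq_top_of_stable hA1 hA4 hvW hv
  have hu : u ∈ W := by rw [htop]; trivial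
  exact hu

/-- The case in which `X₂` is nilpotent: `X₁` and `X₂` have a common kernel, and an eigenvector of
`X₃` in it plays the role of `e(0)`. -/
theorem exists_equiv_MXi (h : Params r s) [IsSimpleModule (UPlus r s)ᵐᵒᵖ N]
    (hX₁ : ∃ k, act N (X₁ r s) ^ k = 0) (hX₂ : ∃ k, act N (X₂ r s) ^ k = 0)
    (hX₃ : Function.Injective (act N (X₃ r s))) :
    ∃ (ξ₁ : ℂˣ) (ξ₂ : ℂ), Nonempty (N ≃ₗ[(UPlus r s)ᵐᵒᵖ] MXi h ξ₁ ξ₂) := by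
  have hr := h.r_ne
  have hs := h.s_ne
  have hr2 : r ^ 2 ≠ 0 := pow_ne_zero 2 hr
  have hs2 : s ^ 2 ≠ 0 := pow_ne_zero 2 hs
  have := IsSimpleModule.nontrivial (UPlus r s)ᵐᵒᵖ N
  obtain ⟨v₀, hv₀⟩ := exists_ne (0 : N)
  obtain ⟨k₁, hk₁⟩ := hX₁
  obtain ⟨k₂, hk₂⟩ := hX₂
  obtain ⟨v₁, -, hv₁, h11⟩ := exists_ne_zero_ker_of_pow_eq_zero (act N (X₁ r s)) ⊤
    (fun _ _ => trivial) (Submodule.mem_top : v₀ ∈ ⊤) hv₀ (by rw [hk₁]; rfl)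
  obtain ⟨v₂, h21, hv₂, h22⟩ := exists_ne_zero_ker_of_pow_eq_zero (act N (X₂ r s))
    (LinearMap.ker (act N (X₁ r s))) (fun w hw => act_eq_zero_of_qcomm hs2 (X₁_mul_X₂ r s) hw)
    h11 hv₁ (by rw [hk₂]; rfl)
  obtain ⟨γ, hγ⟩ := exists_act_eq_smul_of_mem_center (N := N)
    (X₃_pow_mem_center h (pow_orderOf_eq_one (r * s)))
  rw [act_pow] at hγ
  obtain ⟨v, ⟨h1, h2⟩, hv, c, h3⟩ := exists_eigenvector_of_pow (act N (X₃ r s))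
    (LinearMap.ker (act N (X₁ r s)) ⊓ LinearMap.ker (act N (X₂ r s)))
    (fun w hw => ⟨act_eq_zero_of_qcomm (mul_ne_zero hr2 hs2) (X₁_mul_X₃ h) hw.1,
      act_eq_zero_of_qcomm (mul_ne_zero hr hs) (X₂_mul_X₃ h) hw.2⟩)
    h.ord_rs_pos ⟨h21, h22⟩ hv₂ (hγ v₂)
  have hc : c ≠ 0 := by
    rintro rfl
    rw [zero_smul] at h3
    exact hv (hX₃ (h3.trans (map_zero _).symm))
  set d := orderOf (r * s⁻¹) with hd
  have hpd : (r * s⁻¹) ^ d = 1 := pow_orderOf_eq_one _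
  have hd0 : 0 < d := h.ord_p_pos
  set L := Nat.lcm (orderOf (r * s)) d with hL
  have hL0 : 0 < L := Nat.lcm_pos h.ord_rs_pos hd0
  obtain ⟨δ, hδ⟩ := exists_act_eq_smul_of_mem_center (N := N) (X₄_pow_mem_center h hL0
    (orderOf_dvd_iff_pow_eq_one.1 (Nat.dvd_lcm_left _ _))
    (orderOf_dvd_iff_pow_eq_one.1 (Nat.dvd_lcm_right _ _)))
  rw [act_pow] at hδ
  by_cases hδ0 : δ = 0
  · refine ⟨Units.mk0 c hc, 0, nonempty_equiv_MXi h _ _ hv h1 h2 h3 ?_⟩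
    rw [ell₄, if_neg (not_not.2 rfl), zero_smul, ← hd]
    by_contra hne
    have hz1 : act N (X₁ r s) ((act N (X₄ r s) ^ d) v) = 0 := by
      rw [← act_pow]
      exact act_eq_zero_of_qcomm (pow_ne_zero _ hr2)
        (X₁_mul_X₄_pow h (h.two_le_of_pow_eq_one hd0 hpd) hpd) h1
    have hz2 : act N (X₂ r s) ((act N (X₄ r s) ^ d) v) = 0 := by
      rw [← act_pow]
      exact act_eq_zero_of_qcomm (pow_ne_zero _ hs2) (X₂_mul_X₄_pow h hd0 hpd) h2
    have hz3 : act N (X₃ r s) ((act N (X₄ r s) ^ d) v)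
        = (((r * s) ^ d)⁻¹ * c) • (act N (X₄ r s) ^ d) v := by
      have := act_act_of_qcomm (mul_pow_of_qcomm (X₃_mul_X₄ h) d) v
      rw [act_pow, h3, map_smul] at this
      rw [mul_smul, this, smul_smul, inv_mul_cancel₀ (pow_ne_zero _ (mul_ne_zero hr hs)), one_smul]
    -- the submodule generated by `v X₄ᵈ` is everything, so the nilpotent `X₄` is surjective
    have hsurj : Function.Surjective (act N (X₄ r s) ^ d) := by
      intro u
      obtain ⟨p, hp⟩ := aeval_X₄_surjective h hne hz1 hz2 hz3 u
      refine ⟨Polynomial.aeval (act N (X₄ r s)) p v, ?_⟩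
      have e : act N (X₄ r s) ^ d = Polynomial.aeval (act N (X₄ r s))
          (Polynomial.X ^ d : Polynomial ℂ) := by simp
      rw [← hp, ← Module.End.mul_apply, ← Module.End.mul_apply, e, ← map_mul, ← map_mul, mul_comm]
    obtain ⟨u, hu⟩ := hsurj.iterate L v
    rw [← Module.End.pow_apply, ← pow_mul, mul_comm, pow_mul, show act N (X₄ r s) ^ L = 0 from
      LinearMap.ext fun w => by rw [hδ, hδ0, zero_smul]; rfl, zero_pow hd0.ne'] at hu
    exact hv hu.symm
  · refine ⟨Units.mk0 c hc, δ, nonempty_equiv_MXi h _ _ hv h1 h2 h3 ?_⟩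
    rw [ell₄, if_pos hδ0, ← hd, ← hL, hδ]

end Xi

/-! ### The modules `M(ν)` -/

section Nu

variable {r s : ℂ}

namespace MNu

/-- The vector `e(a, b)` of `M(ν)`. -/
noncomputable def e (h : Params r s) (ν₁ ν₂ : ℂˣ) (ν₃ : ℂ) (a : ZMod (ell₃ r s)) (b : ℕ) :
    MNu h ν₁ ν₂ ν₃ :=
  eNu r s ν₃ a b

/-- The vectors `e(a, b)` of `M(ν)`, continued to `b = m₃`. -/
noncomputable def e' (h : Params r s) (ν₁ ν₂ : ℂˣ) (ν₃ : ℂ) (a : ZMod (ell₃ r s)) (b : ℕ) :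
    MNu h ν₁ ν₂ ν₃ :=
  eNu' r s ν₃ a b

variable (h : Params r s) (ν₁ ν₂ : ℂˣ) (ν₃ : ℂ)

theorem act_X₁_zero (a : ZMod (ell₃ r s)) :
    act (MNu h ν₁ ν₂ ν₃) (X₁ r s) (e h ν₁ ν₂ ν₃ a 0) = 0 :=
  (smul_X h ν₁ ν₂ ν₃ _).1.trans (nuX₁_zero _ _ _ _ _)

theorem act_X₁_succ (a : ZMod (ell₃ r s)) {b : ℕ} (hb : b + 1 < m₃ r s ν₃) :
    act (MNu h ν₁ ν₂ ν₃) (X₁ r s) (e h ν₁ ν₂ ν₃ a (b + 1)) =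
      (-(((s ^ 4) ^ b)⁻¹ * ((r * s) ^ 2)⁻¹ * (1 - r⁻¹ * s)
        * ((1 - (r⁻¹ * s) ^ (2 * (b + 1))) / (1 - (r⁻¹ * s) ^ 2)) * (ν₁ : ℂ) ^ 2))
        • e h ν₁ ν₂ ν₃ (a + 2) b :=
  (smul_X h ν₁ ν₂ ν₃ _).1.trans (nuX₁_succ _ _ _ _ _ hb)

theorem act_X₂ (a : ZMod (ell₃ r s)) {b : ℕ} (hb : b < m₃ r s ν₃) :
    act (MNu h ν₁ ν₂ ν₃) (X₂ r s) (e h ν₁ ν₂ ν₃ a b) =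
      (((s ^ 2) ^ b)⁻¹ * (ν₁ : ℂ)) • e h ν₁ ν₂ ν₃ (a + 1) b :=
  (smul_X h ν₁ ν₂ ν₃ _).2.1.trans (nuX₂_apply _ _ _ _ _ hb)

theorem act_X₃ (a : ZMod (ell₃ r s)) {b : ℕ} (hb : b < m₃ r s ν₃) :
    act (MNu h ν₁ ν₂ ν₃) (X₃ r s) (e h ν₁ ν₂ ν₃ a b) =
      ((r * s) ^ a.val * (ν₂ : ℂ)) • e h ν₁ ν₂ ν₃ a b :=
  (smul_X h ν₁ ν₂ ν₃ _).2.2.1.trans (nuX₃_apply _ _ _ _ _ hb)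

theorem act_X₄ (a : ZMod (ell₃ r s)) {b : ℕ} (hb : b < m₃ r s ν₃) :
    act (MNu h ν₁ ν₂ ν₃) (X₄ r s) (e h ν₁ ν₂ ν₃ a b) =
      ((s ^ 2) ^ b / ((s ^ 2)⁻¹ - r⁻¹ * s⁻¹)) • ((ν₁ : ℂ)⁻¹ • e' h ν₁ ν₂ ν₃ (a - 1) (b + 1)
        - ((r * s) ^ (a - 1).val * (ν₁ : ℂ)⁻¹ * (ν₂ : ℂ)) • e h ν₁ ν₂ ν₃ (a - 1) b) :=
  (smul_X h ν₁ ν₂ ν₃ _).2.2.2.trans (nuX₄_apply h _ _ _ _ hb)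

end MNu

theorem Params.coeff_ne (h : Params r s) : (s ^ 2)⁻¹ - r⁻¹ * s⁻¹ ≠ 0 := by
  intro e
  have hr := h.r_ne
  have hs := h.s_ne
  field_simp at e
  exact h.sub_ne (by simpa using e)

namespace MNu

variable (h : Params r s) (ν₁ ν₂ : ℂˣ) (ν₃ : ℂ)

theorem act_zElt (a : ZMod (ell₃ r s)) {b : ℕ} (hb : b < m₃ r s ν₃) :
    act (MNu h ν₁ ν₂ ν₃) (zElt r s) (e h ν₁ ν₂ ν₃ a b) =
      e' h ν₁ ν₂ ν₃ a (b + 1) := by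
  have hc := h.coeff_ne
  have hs : (s ^ 2) ^ b ≠ 0 := pow_ne_zero _ (pow_ne_zero _ h.s_ne)
  have hν := ν₁.ne_zero
  rw [zElt, act_add, act_smul, act_mul, LinearMap.add_apply, LinearMap.smul_apply,
    Module.End.mul_apply, act_X₂ _ _ _ _ _ hb, map_smul, act_X₄ _ _ _ _ _ hb, act_X₃ _ _ _ _ _ hb,
    add_sub_cancel_right]
  generalize (s ^ 2)⁻¹ - r⁻¹ * s⁻¹ = c at *
  match_scalars
  · field_simp
    ring
  · field_simp

end MNu

theorem act_zElt_act_X₁ (h : Params r s) {N : Type*} [AddCommGroup N] [Module ℂ N]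
    [Module (UPlus r s)ᵐᵒᵖ N] [IsScalarTower ℂ (UPlus r s)ᵐᵒᵖ N] (u : N) :
    act N (zElt r s) (act N (X₁ r s) u) = (r ^ 2 * s ^ 2) • act N (X₁ r s) (act N (zElt r s) u)
      + (1 - r⁻¹ * s) • act N (X₂ r s) (act N (X₂ r s) u) := by
  rw [← act_mul_apply, X₁_mul_zElt h, act_add, act_smul, act_smul, pow_two (X₂ r s), act_mul,
    act_mul]
  rfl

theorem zElt_pow_mul_X₂ (h : Params r s) (m : ℕ) :
    zElt r s ^ m * X₂ r s = ((s ^ 2) ^ m)⁻¹ • (X₂ r s * zElt r s ^ m) := by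
  rw [mul_pow_of_qcomm (X₂_mul_zElt h), smul_smul,
    inv_mul_cancel₀ (pow_ne_zero _ (pow_ne_zero 2 h.s_ne)), one_smul]

theorem zElt_pow_mul_X₄ (h : Params r s) (m : ℕ) :
    X₄ r s * zElt r s ^ m = (((s ^ 2)⁻¹) ^ m) • (zElt r s ^ m * X₄ r s) :=
  mul_pow_of_qcomm (by
    rw [zElt_mul_X₄ h, smul_smul, inv_mul_cancel₀ (pow_ne_zero 2 h.s_ne), one_smul]) m

/-- The joint eigenvalues of `X₃`, `X₂^ℓ₃` and `X₁ z X₂^{2l-2}` on the vectors `e(a, b)` separate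
the indices. -/
theorem nu_index_ext (h : Params r s) (ν₃ : ℂ) {a a' b b' : ℕ} (ha : a < ell₃ r s)
    (ha' : a' < ell₃ r s) (hb : b < m₃ r s ν₃) (hb' : b' < m₃ r s ν₃)
    (e₀ : (r * s) ^ a = (r * s) ^ a') (e₁ : ((s ^ 2) ^ b) ^ ell₃ r s = ((s ^ 2) ^ b') ^ ell₃ r s)
    (e₂ : (r⁻¹ * s) ^ (2 * b) = (r⁻¹ * s) ^ (2 * b')) : a = a' ∧ b = b' := by
  have hr := h.r_ne
  have hs := h.s_ne
  constructor
  · wlog hle : a ≤ a' generalizing a a'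
    · exact (this ha' ha e₀.symm (le_of_not_ge hle)).symm
    have := Nat.eq_zero_of_dvd_of_lt (orderOf_dvd_sub_of_pow_eq (mul_ne_zero hr hs) hle e₀)
      (lt_of_le_of_lt (Nat.sub_le _ _) ha')
    omega
  · wlog hle : b ≤ b' generalizing b b'
    · exact (this hb' hb e₁.symm e₂.symm (le_of_not_ge hle)).symm
    have hq : (r⁻¹ * s) ^ 2 = (r ^ 2)⁻¹ * s ^ 2 := by rw [mul_pow, inv_pow]
    rw [pow_mul, pow_mul, hq] at e₂
    have d2 := orderOf_dvd_sub_of_pow_eq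
      (mul_ne_zero (inv_ne_zero (pow_ne_zero 2 hr)) (pow_ne_zero 2 hs)) hle e₂
    rw [← pow_mul (s ^ 2) b, ← pow_mul (s ^ 2) b'] at e₁
    have d1 := orderOf_dvd_sub_of_pow_eq (pow_ne_zero 2 hs) (Nat.mul_le_mul_right _ hle) e₁
    rw [← Nat.sub_mul] at d1
    obtain ⟨k, hk⟩ := d2
    have hlt : b' - b < m₃ r s ν₃ := by omega
    unfold m₃ at hlt
    have hpos := h.ord_q_pos
    split_ifs at hlt with hc
    · rw [hk] at hlt
      have : k < 1 := Nat.lt_of_mul_lt_mul_left (a := orderOf ((r ^ 2)⁻¹ * s ^ 2)) (by omega)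
      obtain rfl : k = 0 := by omega
      omega
    · rw [hk] at hlt
      have : k < 2 := Nat.lt_of_mul_lt_mul_left (a := orderOf ((r ^ 2)⁻¹ * s ^ 2)) (by omega)
      interval_cases k
      · omega
      · rw [hk, mul_one] at d1
        exact absurd (Or.inl d1) hc

variable {N : Type*} [AddCommGroup N] [Module ℂ N] [Module (UPlus r s)ᵐᵒᵖ N]
  [IsScalarTower ℂ (UPlus r s)ᵐᵒᵖ N]

/-- A simple module with a vector `v` that has the properties of `e(0, 0)` is `M(ν)`, through
`e(a, b) ↦ ν₁⁻ᵃ v X₂ᵃ zᵇ`. -/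
theorem nonempty_equiv_MNu (h : Params r s) [IsSimpleModule (UPlus r s)ᵐᵒᵖ N]
    {l : ℕ} (hl : 0 < l) (hl₁ : (r * s) ^ l = 1) (hl₂ : (r * s⁻¹) ^ l = 1) (ν₁ ν₂ : ℂˣ) (ν₃ : ℂ)
    {v : N} (hv : v ≠ 0) (h₁ : act N (X₁ r s) v = 0)
    (h₂ : (act N (X₂ r s) ^ ell₃ r s) v = ((ν₁ : ℂ) ^ ell₃ r s) • v)
    (h₃ : act N (X₃ r s) v = (ν₂ : ℂ) • v)
    (hz : (act N (zElt r s) ^ m₃ r s ν₃) v = ν₃ • v) :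
    Nonempty (N ≃ₗ[(UPlus r s)ᵐᵒᵖ] MNu h ν₁ ν₂ ν₃) := by
  have hr := h.r_ne
  have hs := h.s_ne
  have hn := ν₁.ne_zero
  have hn2 := ν₂.ne_zero
  have hm := m₃_pos h ν₃
  have hl3 : 0 < ell₃ r s := h.ord_rs_pos
  have : NeZero (ell₃ r s) := ⟨hl3.ne'⟩
  set M := MNu h ν₁ ν₂ ν₃
  set Z := act N (zElt r s) with hZ
  set B := act N (X₂ r s) with hB
  let f : ℕ → ℕ → N := fun n b => ((ν₁ : ℂ)⁻¹ ^ n) • (Z ^ b) ((B ^ n) v)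
  -- `f n b` depends on `n` modulo `ℓ₃` only
  have hper : ∀ n b, f n b = f (n % ell₃ r s) b := by
    intro n b
    have e1 : (B ^ (ell₃ r s * (n / ell₃ r s))) v
        = ((ν₁ : ℂ) ^ (ell₃ r s * (n / ell₃ r s))) • v := by
      rw [pow_mul, pow_apply_of_eigenvector h₂, ← pow_mul]
    have e2 : n = n % ell₃ r s + ell₃ r s * (n / ell₃ r s) := (Nat.mod_add_div _ _).symm
    change ((ν₁ : ℂ)⁻¹ ^ n) • (Z ^ b) ((B ^ n) v) = _
    conv_lhs => rw [e2]
    rw [pow_add B, Module.End.mul_apply, e1, map_smul, map_smul, smul_smul, pow_add, mul_assoc,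
      ← mul_pow, inv_mul_cancel₀ hn, one_pow, mul_one]
  have hfB : ∀ n b, B (f n b) = (((s ^ 2) ^ b)⁻¹ * (ν₁ : ℂ)) • f (n + 1) b := by
    intro n b
    have e1 := act_act_of_qcomm (zElt_pow_mul_X₂ h b) ((B ^ n) v)
    rw [act_pow] at e1
    change B (((ν₁ : ℂ)⁻¹ ^ n) • (Z ^ b) ((B ^ n) v)) = _
    rw [map_smul, e1]
    change _ = _ • (((ν₁ : ℂ)⁻¹ ^ (n + 1)) • (Z ^ b) ((B ^ (n + 1)) v))
    rw [smul_smul, smul_smul, pow_succ' B n, Module.End.mul_apply]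
    congr 1
    rw [pow_succ (ν₁ : ℂ)⁻¹]
    generalize (ν₁ : ℂ)⁻¹ ^ n = x
    field_simp
  have hf3 : ∀ n b, act N (X₃ r s) (f n b) = ((r * s) ^ n * (ν₂ : ℂ)) • f n b := by
    intro n b
    have c1 : X₃ r s * zElt r s ^ b = zElt r s ^ b * X₃ r s :=
      Commute.pow_right (X₃_mul_zElt h) b
    have c2 := mul_pow_of_qcomm (X₃_mul_X₂ h) n
    have e1 : act N (X₃ r s) ((Z ^ b) ((B ^ n) v)) = (Z ^ b) (act N (X₃ r s) ((B ^ n) v)) := by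
      rw [← act_pow, ← act_mul_apply, ← act_mul_apply, c1]
    have e2 : act N (X₃ r s) ((B ^ n) v) = ((r * s) ^ n * (ν₂ : ℂ)) • (B ^ n) v := by
      have := act_act_of_qcomm c2 v
      rw [h₃, act_pow, map_smul] at this
      rw [mul_smul, this, smul_smul, inv_pow, mul_inv_cancel₀ (pow_ne_zero _ (mul_ne_zero hr hs)),
        one_smul]
    change act N (X₃ r s) (((ν₁ : ℂ)⁻¹ ^ n) • (Z ^ b) ((B ^ n) v)) = _
    rw [map_smul, e1, e2, map_smul, smul_comm]
  have hfm : ∀ n, f n (m₃ r s ν₃) = ((s ^ (2 * m₃ r s ν₃)) ^ n * ν₃) • f n 0 := by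
    intro n
    have e1 := act_act_of_qcomm (mul_pow_of_qcomm (zElt_pow_mul_X₂ h (m₃ r s ν₃)) n) v
    rw [act_pow, act_pow, ← hZ, ← hB, hz, map_smul] at e1
    have hne : ((s ^ 2) ^ m₃ r s ν₃) ^ n ≠ 0 :=
      pow_ne_zero _ (pow_ne_zero _ (pow_ne_zero _ hs))
    have e2 : (Z ^ m₃ r s ν₃) ((B ^ n) v) = (((s ^ 2) ^ m₃ r s ν₃) ^ n * ν₃) • (B ^ n) v := by
      rw [mul_smul, e1, smul_smul, inv_pow, mul_inv_cancel₀ hne, one_smul]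
    change ((ν₁ : ℂ)⁻¹ ^ n) • (Z ^ m₃ r s ν₃) ((B ^ n) v)
      = _ • (((ν₁ : ℂ)⁻¹ ^ n) • (Z ^ 0) ((B ^ n) v))
    rw [e2, smul_comm, pow_zero, Module.End.one_apply, pow_mul]
  let w : ZMod (ell₃ r s) × Fin (m₃ r s ν₃) → N := fun p => f p.1.val p.2
  let φ : M →ₗ[ℂ] N := (Finsupp.linearCombination ℂ w : VNu r s ν₃ →ₗ[ℂ] N)
  let e : ZMod (ell₃ r s) → ℕ → M := MNu.e h ν₁ ν₂ ν₃
  have hφ0 : ∀ a b, b < m₃ r s ν₃ → φ (e a b) = f a.val b := fun a b hb => by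
    change Finsupp.linearCombination ℂ w (eNu r s ν₃ a b) = _
    rw [eNu, dif_pos hb]
    exact (Finsupp.linearCombination_single ℂ _ _).trans (one_smul ℂ _)
  have hφ : ∀ (a : ZMod (ell₃ r s)) (n b : ℕ), (n : ZMod (ell₃ r s)) = a → b < m₃ r s ν₃ →
      φ (e a b) = f n b := by
    rintro _ n b rfl hb
    rw [hφ0 _ _ hb, ZMod.val_natCast, ← hper]
  have hφ' : ∀ a b, b ≤ m₃ r s ν₃ → φ (MNu.e' h ν₁ ν₂ ν₃ a b) = f a.val b := fun a b hb => by
    unfold MNu.e' eNu'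
    split_ifs with hc
    · refine (map_smul φ _ _).trans ?_
      rw [hc, hfm, ← hφ0 a 0 hm]
      rfl
    · exact hφ0 a b (by omega)
  have hext : ∀ {g g' : M →ₗ[ℂ] N}, (∀ a b, b < m₃ r s ν₃ → g (e a b) = g' (e a b)) →
      ∀ u, g u = g' u := fun H u =>
    LinearMap.congr_fun (ext_nu (r := r) (s := s) (ν₃ := ν₃) H) u
  have i2 : ∀ u, φ (act M (X₂ r s) u) = B (φ u) := by
    refine hext (g := φ ∘ₗ act M (X₂ r s)) (g' := B ∘ₗ φ) fun a b hb => ?_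
    rw [LinearMap.comp_apply, LinearMap.comp_apply, MNu.act_X₂ _ _ _ _ _ hb, map_smul,
      hφ (a + 1) (a.val + 1) b (by simp) hb, hφ0 _ _ hb, hfB]
  have i3 : ∀ u, φ (act M (X₃ r s) u) = act N (X₃ r s) (φ u) := by
    refine hext (g := φ ∘ₗ act M (X₃ r s)) (g' := act N (X₃ r s) ∘ₗ φ) fun a b hb => ?_
    rw [LinearMap.comp_apply, LinearMap.comp_apply, MNu.act_X₃ _ _ _ _ _ hb, map_smul,
      hφ0 _ _ hb, hf3]
  have iz : ∀ u, φ (act M (zElt r s) u) = Z (φ u) := by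
    refine hext (g := φ ∘ₗ act M (zElt r s)) (g' := Z ∘ₗ φ) fun a b hb => ?_
    rw [LinearMap.comp_apply, LinearMap.comp_apply, MNu.act_zElt _ _ _ _ _ hb, hφ' _ _ hb,
      hφ0 _ _ hb]
    change _ = Z (_ • _)
    rw [map_smul, ← Module.End.mul_apply, ← pow_succ']
  -- `X₄` is determined by `z` and `X₃` on the image of `X₂`, which is everything
  have i4' : ∀ u, φ (act M (X₄ r s) (act M (X₂ r s) u)) = act N (X₄ r s) (φ (act M (X₂ r s) u)) := by
    intro u
    have e1 := iz u
    rw [hZ, zElt] at e1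
    simp only [act_add, act_smul, act_mul, LinearMap.add_apply, LinearMap.smul_apply,
      Module.End.mul_apply, map_add, map_smul, i3] at e1
    rw [i2]
    exact smul_right_injective N h.coeff_ne (add_left_cancel e1)
  have i4 : ∀ u, φ (act M (X₄ r s) u) = act N (X₄ r s) (φ u) := by
    refine hext (g := φ ∘ₗ act M (X₄ r s)) (g' := act N (X₄ r s) ∘ₗ φ) fun a b hb => ?_
    have e1 : e a b = act M (X₂ r s) ((((s ^ 2) ^ b)⁻¹ * (ν₁ : ℂ))⁻¹ • e (a - 1) b) := by
      rw [map_smul, MNu.act_X₂ _ _ _ _ _ hb, smul_smul, inv_mul_cancel₀, one_smul, sub_add_cancel]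
      exact mul_ne_zero (inv_ne_zero (pow_ne_zero _ (pow_ne_zero _ hs))) hn
    rw [LinearMap.comp_apply, LinearMap.comp_apply, e1]
    exact i4' _
  have i1' : ∀ b, b < m₃ r s ν₃ → ∀ a,
      φ (act M (X₁ r s) (e a b)) = act N (X₁ r s) (φ (e a b)) := by
    intro b
    induction b with
    | zero =>
      intro hb a
      have e1 := act_act_of_qcomm (mul_pow_of_qcomm (X₁_mul_X₂ r s) a.val) v
      rw [h₁, map_zero, act_pow] at e1
      have e2 := (smul_eq_zero.1 e1.symm).resolve_left (pow_ne_zero _ (pow_ne_zero 2 hs))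
      rw [MNu.act_X₁_zero, map_zero, hφ0 _ _ hb]
      change _ = act N (X₁ r s) (_ • (Z ^ 0) ((B ^ a.val) v))
      rw [map_smul, pow_zero, Module.End.one_apply, e2, smul_zero]
    | succ b ih =>
      intro hb a
      have e1 : e a (b + 1) = act M (zElt r s) (e a b) := by
        rw [MNu.act_zElt _ _ _ _ _ (by omega), MNu.e', eNu', if_neg hb.ne]
        rfl
      have e2 := act_zElt_act_X₁ h (e a b)
      have e3 := act_zElt_act_X₁ h (φ (e a b))
      rw [← sub_eq_iff_eq_add] at e2 e3
      refine smul_right_injective N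
        (mul_ne_zero (pow_ne_zero 2 hr) (pow_ne_zero 2 hs) : r ^ 2 * s ^ 2 ≠ 0) ?_
      change (r ^ 2 * s ^ 2) • _ = (r ^ 2 * s ^ 2) • _
      rw [e1, ← map_smul, ← e2, iz, ← e3, map_sub, map_smul, iz, i2, i2, ih (by omega)]
  have i1 : ∀ u, φ (act M (X₁ r s) u) = act N (X₁ r s) (φ u) :=
    hext (g := φ ∘ₗ act M (X₁ r s)) (g' := act N (X₁ r s) ∘ₗ φ) fun a b hb => i1' b hb a
  have hE : (1 : ℂ) - r⁻¹ * s ≠ 0 := fun e => h.sub_ne (by field_simp at e; simpa using e)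
  have hF : (1 : ℂ) - (r⁻¹ * s) ^ 2 ≠ 0 := fun e => h.sq_ne (by
    field_simp at e; linear_combination e)
  have hBne : ∀ n, (B ^ n) v ≠ 0 := by
    intro n hzero
    have e1 : (B ^ (ell₃ r s * n)) v ≠ 0 := by
      rw [pow_mul, pow_apply_of_eigenvector h₂]
      exact smul_ne_zero (pow_ne_zero _ (pow_ne_zero _ hn)) hv
    refine e1 ?_
    have : ell₃ r s * n = (ell₃ r s * n - n) + n :=
      (Nat.sub_add_cancel (Nat.le_mul_of_pos_left n hl3)).symm
    rw [this, pow_add, Module.End.mul_apply, hzero, map_zero]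
  have hf0 : ∀ n, f n 0 ≠ 0 := fun n => smul_ne_zero (pow_ne_zero _ (inv_ne_zero hn)) (hBne n)
  have hne : ∀ b, b < m₃ r s ν₃ → ∀ a, φ (e a b) ≠ 0 := by
    by_cases h0 : ν₃ = 0
    · -- here `m₃` is the order of `r⁻²s²`, so `X₁` maps `e(a, b + 1)` to a non-zero multiple of
      -- `e(a + 2, b)`
      intro b
      induction b with
      | zero => intro hb a; rw [hφ0 _ _ hb]; exact hf0 _
      | succ b ih =>
        intro hb a hzero
        have e1 := i1 (e a (b + 1))
        rw [hzero, map_zero, MNu.act_X₁_succ _ _ _ _ _ hb, map_smul] at e1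
        refine smul_ne_zero ?_ (ih (by omega) _) e1
        refine neg_ne_zero.2 (mul_ne_zero (mul_ne_zero (mul_ne_zero (mul_ne_zero
          (inv_ne_zero (pow_ne_zero _ (pow_ne_zero _ hs)))
          (inv_ne_zero (pow_ne_zero _ (mul_ne_zero hr hs)))) hE)
          (div_ne_zero (fun e2 => ?_) hF)) (pow_ne_zero _ hn))
        rw [sub_eq_zero, eq_comm, pow_mul, mul_pow, inv_pow] at e2
        have := orderOf_le_of_pow_eq_one (Nat.succ_pos b) e2
        rw [m₃, if_pos (Or.inr h0)] at hb
        omega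
    · intro b hb a hzero
      rw [hφ0 _ _ hb] at hzero
      have e1 : (Z ^ b) ((B ^ a.val) v) = 0 :=
        (smul_eq_zero.1 hzero).resolve_left (pow_ne_zero _ (inv_ne_zero hn))
      have e2 : f a.val (m₃ r s ν₃) = 0 := by
        change _ • (Z ^ m₃ r s ν₃) ((B ^ a.val) v) = 0
        rw [← Nat.sub_add_cancel hb.le, pow_add, Module.End.mul_apply, e1, map_zero, smul_zero]
      rw [hfm] at e2
      exact smul_ne_zero (mul_ne_zero (pow_ne_zero _ (pow_ne_zero _ hs)) h0) (hf0 _) e2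
  obtain ⟨k, rfl⟩ : ∃ k, l = k + 1 := ⟨l - 1, by omega⟩
  have hl3k : ((k + 1 : ℕ) : ZMod (ell₃ r s)) = 0 :=
    (ZMod.natCast_eq_zero_iff _ _).2 (orderOf_dvd_of_pow_eq_one hl₁)
  have hBpow : ∀ (j : ℕ) (a : ZMod (ell₃ r s)) b, b < m₃ r s ν₃ →
      (B ^ j) (φ (e a b)) = (((s ^ 2) ^ b)⁻¹ * (ν₁ : ℂ)) ^ j • φ (e (a + j) b) := by
    intro j
    induction j with
    | zero => intro a b _; simp
    | succ j ih =>
      intro a b hb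
      rw [pow_succ', Module.End.mul_apply, ih a b hb, map_smul, ← i2, MNu.act_X₂ _ _ _ _ _ hb,
        map_smul, smul_smul, pow_succ (((s ^ 2) ^ b)⁻¹ * (ν₁ : ℂ)) j, Nat.cast_succ, ← add_assoc]
  -- the eigenvalue of `X₁ z X₂^{2k}` on `e(a, b)` is `C (1 - (r⁻¹s)^{2b})`
  set C : ℂ := -(s ^ 4 * ((r * s) ^ 2)⁻¹ * (1 - r⁻¹ * s) / (1 - (r⁻¹ * s) ^ 2)
    * (ν₁ : ℂ) ^ (2 * k + 2)) with hC
  have hC0 : C ≠ 0 := neg_ne_zero.2 (mul_ne_zero (div_ne_zero (mul_ne_zero (mul_ne_zero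
    (pow_ne_zero _ hs) (inv_ne_zero (pow_ne_zero _ (mul_ne_zero hr hs)))) hE) hF)
    (pow_ne_zero _ hn))
  have hinj : Function.Injective φ := by
    refine linearIndependent_of_joint_eigenvectors
      ![act N (X₃ r s), B ^ ell₃ r s, B ^ (2 * k) * Z * act N (X₁ r s)]
      (fun (p : ZMod (ell₃ r s) × Fin (m₃ r s ν₃)) => ![(r * s) ^ p.1.val * (ν₂ : ℂ),
        (((s ^ 2) ^ (p.2 : ℕ))⁻¹ * (ν₁ : ℂ)) ^ ell₃ r s, C * (1 - (r⁻¹ * s) ^ (2 * (p.2 : ℕ)))])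
      ?_ w ?_ ?_
    · rintro ⟨a, b⟩ ⟨a', b'⟩ hab
      have e0 : (r * s) ^ a.val * (ν₂ : ℂ) = (r * s) ^ a'.val * (ν₂ : ℂ) := congrFun hab 0
      have e1 : (((s ^ 2) ^ (b : ℕ))⁻¹ * (ν₁ : ℂ)) ^ ell₃ r s
        = (((s ^ 2) ^ (b' : ℕ))⁻¹ * (ν₁ : ℂ)) ^ ell₃ r s := congrFun hab 1
      have e2 : C * (1 - (r⁻¹ * s) ^ (2 * (b : ℕ))) = C * (1 - (r⁻¹ * s) ^ (2 * (b' : ℕ))) :=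
        congrFun hab 2
      rw [mul_pow, mul_pow, inv_pow, inv_pow] at e1
      obtain ⟨ha, hb⟩ := nu_index_ext h ν₃ (ZMod.val_lt a) (ZMod.val_lt a') b.2 b'.2
        (mul_right_cancel₀ hn2 e0) (inv_injective (mul_right_cancel₀ (pow_ne_zero _ hn) e1))
        (sub_right_injective (mul_left_cancel₀ hC0 e2))
      exact Prod.ext (ZMod.val_injective _ ha) (Fin.ext hb)
    · rintro ⟨a, b⟩
      change f a.val b ≠ 0
      rw [← hφ0 a b b.2]
      exact hne b b.2 a
    · rintro ⟨a, b, hb⟩ i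
      have hw : w (a, ⟨b, hb⟩) = φ (e a b) := (hφ0 a b hb).symm
      rw [hw]
      fin_cases i
      · change act N (X₃ r s) (φ (e a b)) = ((r * s) ^ a.val * (ν₂ : ℂ)) • φ (e a b)
        rw [← i3, MNu.act_X₃ _ _ _ _ _ hb, map_smul]
      · change (B ^ ell₃ r s) (φ (e a b)) = (((s ^ 2) ^ b)⁻¹ * (ν₁ : ℂ)) ^ ell₃ r s • φ (e a b)
        rw [hBpow _ _ _ hb, ZMod.natCast_self, add_zero]
      · change (B ^ (2 * k)) (Z (act N (X₁ r s) (φ (e a b))))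
          = (C * (1 - (r⁻¹ * s) ^ (2 * b))) • φ (e a b)
        rw [← i1]
        rcases b with _ | b
        · rw [MNu.act_X₁_zero]
          simp
        · have e1 : act M (zElt r s) (e (a + 2) b) = e (a + 2) (b + 1) := by
            rw [MNu.act_zElt _ _ _ _ _ (by omega), MNu.e', eNu', if_neg hb.ne]
            rfl
          have e2 : a + 2 + ((2 * k : ℕ) : ZMod (ell₃ r s)) = a := by
            have : (2 : ZMod (ell₃ r s)) + ((2 * k : ℕ) : ZMod (ell₃ r s))
                = 2 * ((k + 1 : ℕ) : ZMod (ell₃ r s)) := by push_cast; ring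
            rw [add_assoc, this, hl3k, mul_zero, add_zero]
          have e3 : (((s ^ 2) ^ (b + 1))⁻¹) ^ (2 * k) = ((s ^ 2) ^ (b + 1)) ^ 2 := by
            have hs2 := (sq_pow_eq_one h hl₁ hl₂).2
            rw [inv_pow]
            refine inv_eq_of_mul_eq_one_right ?_
            rw [← pow_add, ← pow_mul (s ^ 2), show (b + 1) * (2 * k + 2) = (k + 1) * (2 * (b + 1)) by
              ring, pow_mul (s ^ 2), hs2, one_pow]
          rw [MNu.act_X₁_succ _ _ _ _ _ hb, map_smul, map_smul, ← iz, map_smul]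
          change _ • (B ^ (2 * k)) (φ (act M (zElt r s) (e (a + 2) b))) = _
          rw [e1, hBpow _ _ _ hb, e2, smul_smul, mul_pow ((s ^ 2) ^ (b + 1))⁻¹, e3, hC, pow_add (ν₁ : ℂ)]
          congr 1
          rw [show (s ^ 4) ^ b = ((s ^ 2) ^ b) ^ 2 by ring, pow_succ (s ^ 2) b]
          have hS : (s ^ 2) ^ b ≠ 0 := pow_ne_zero _ (pow_ne_zero _ hs)
          generalize (s ^ 2) ^ b = S at *
          generalize (1 - (r⁻¹ * s) ^ 2) = F at *
          generalize (1 - (r⁻¹ * s) ^ (2 * (b + 1))) = G at *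
          generalize 1 - r⁻¹ * s = E at *
          field_simp
  have : Nontrivial M := by
    have : Nonempty (ZMod (ell₃ r s) × Fin (m₃ r s ν₃)) := ⟨(0, ⟨0, hm⟩)⟩
    exact inferInstanceAs (Nontrivial (VNu r s ν₃))
  exact nonempty_equiv_of_injective (M := M) (φ := φ) hinj i1 i4

theorem act_eigenvector_of_commute {x y : UPlus r s} (hxy : x * y = y * x) {v : N} {c : ℂ}
    (hv : act N x v = c • v) : act N x (act N y v) = c • act N y v := by
  rw [← act_mul_apply, ← hxy, act_mul_apply, hv, map_smul]

/-- The case in which `X₂` is invertible: the role of `e(0, 0)` is played by a joint eigenvector of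
`X₃`, `X₂^ℓ₃` and `z^m₃` in the kernel of `X₁`. -/
theorem exists_equiv_MNu (h : Params r s) [IsSimpleModule (UPlus r s)ᵐᵒᵖ N]
    {l : ℕ} (hl : 0 < l) (hl₁ : (r * s) ^ l = 1) (hl₂ : (r * s⁻¹) ^ l = 1)
    (hX₁ : ∃ k, act N (X₁ r s) ^ k = 0) {β : ℂ} (hβ : β ≠ 0)
    (hX₂ : ∀ v, (act N (X₂ r s) ^ l) v = β • v) (hX₃ : Function.Injective (act N (X₃ r s))) :
    ∃ (ν₁ ν₂ : ℂˣ) (ν₃ : ℂ), Nonempty (N ≃ₗ[(UPlus r s)ᵐᵒᵖ] MNu h ν₁ ν₂ ν₃) := by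
  have hr := h.r_ne
  have hs := h.s_ne
  have hr2 : r ^ 2 ≠ 0 := pow_ne_zero 2 hr
  have hs2 : s ^ 2 ≠ 0 := pow_ne_zero 2 hs
  have hl3 : 0 < ell₃ r s := h.ord_rs_pos
  have := IsSimpleModule.nontrivial (UPlus r s)ᵐᵒᵖ N
  obtain ⟨v₀, hv₀⟩ := exists_ne (0 : N)
  obtain ⟨k₁, hk₁⟩ := hX₁
  obtain ⟨v₁, -, hv₁, h11⟩ := exists_ne_zero_ker_of_pow_eq_zero (act N (X₁ r s)) ⊤
    (fun _ _ => trivial) (Submodule.mem_top : v₀ ∈ ⊤) hv₀ (by rw [hk₁]; rfl)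
  obtain ⟨γ, hγ⟩ := exists_act_eq_smul_of_mem_center (N := N) (X₃_pow_mem_center h hl₁)
  rw [act_pow] at hγ
  obtain ⟨v₂, h21, hv₂, c, h23⟩ := exists_eigenvector_of_pow (act N (X₃ r s))
    (LinearMap.ker (act N (X₁ r s)))
    (fun w hw => act_eq_zero_of_qcomm (mul_ne_zero hr2 hs2) (X₁_mul_X₃ h) hw) hl h11 hv₁ (hγ v₁)
  have hc : c ≠ 0 := by
    rintro rfl
    rw [zero_smul] at h23
    exact hv₂ (hX₃ (h23.trans (map_zero _).symm))
  have c32 : X₃ r s * X₂ r s ^ ell₃ r s = X₂ r s ^ ell₃ r s * X₃ r s :=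
    commute_pow_of_qcomm (X₃_mul_X₂ h) (by
      rw [inv_pow, show (r * s) ^ ell₃ r s = 1 from pow_orderOf_eq_one _, inv_one])
  have hT : ∀ w, (act N (X₂ r s ^ ell₃ r s) ^ l) w = β ^ ell₃ r s • w := fun w => by
    rw [act_pow, ← pow_mul, mul_comm, pow_mul]
    exact pow_apply_of_eigenvector (hX₂ w) _
  obtain ⟨v₃, ⟨h31, h33⟩, hv₃, η, h32⟩ := exists_eigenvector_of_pow (act N (X₂ r s ^ ell₃ r s))
    (LinearMap.ker (act N (X₁ r s)) ⊓ Module.End.eigenspace (act N (X₃ r s)) c)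
    (fun w hw => ⟨act_eq_zero_of_qcomm (pow_ne_zero _ hs2)
        (mul_pow_of_qcomm (X₁_mul_X₂ r s) _) hw.1,
      Module.End.mem_eigenspace_iff.2
        (act_eigenvector_of_commute c32 (Module.End.mem_eigenspace_iff.1 hw.2))⟩)
    hl ⟨h21, Module.End.mem_eigenspace_iff.2 h23⟩ hv₂ (hT v₂)
  have hη : η ≠ 0 := by
    rintro rfl
    have e1 := hT v₃
    rw [pow_apply_of_eigenvector h32, zero_pow hl.ne', zero_smul] at e1
    exact smul_ne_zero (pow_ne_zero _ hβ) hv₃ e1.symm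
  obtain ⟨ν, hν⟩ := IsAlgClosed.exists_pow_nat_eq η hl3
  have hν0 : ν ≠ 0 := by
    rintro rfl
    rw [zero_pow hl3.ne'] at hν
    exact hη hν.symm
  have hqs : ∀ m, (r⁻¹ * s) ^ (2 * m) = 1 → (r ^ 2) ^ m = (s ^ 2) ^ m := by
    intro m e
    rw [pow_mul, mul_pow, inv_pow, mul_pow, inv_pow] at e
    have := pow_ne_zero m hr2
    field_simp at e
    exact e.symm
  obtain ⟨ζ, hζ⟩ := exists_act_eq_smul_of_mem_center (N := N) (zElt_pow_mem_center h hl hl₁ hl₂)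
  by_cases hζ0 : ζ = 0
  · refine ⟨Units.mk0 ν hν0, Units.mk0 c hc, 0, nonempty_equiv_MNu h hl hl₁ hl₂ _ _ _ hv₃ h31 ?_
      (Module.End.mem_eigenspace_iff.1 h33) ?_⟩
    · rw [← act_pow, h32, Units.val_mk0, hν]
    rw [zero_smul]
    have hm := m₃_pos h 0
    have hqm := hqs _ (q_pow_m₃ r s 0)
    set m := m₃ r s 0
    by_contra hne
    rw [← act_pow] at hne
    -- the image of `zᵐ` is a submodule, so the nilpotent `zᵐ` is surjective
    have htop : LinearMap.range (act N (zElt r s ^ m)) = ⊤ := by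
      refine eq_top_of_stable (r := r) (s := s) ?_ ?_ (LinearMap.mem_range_self _ v₃) hne
      · rintro _ ⟨u, rfl⟩
        have e1 := act_act_of_qcomm (X₁_mul_zElt_pow h hm hqm) u
        refine (Submodule.smul_mem_iff _ (pow_ne_zero m (mul_ne_zero hr2 hs2))).1 ?_
        rw [← e1]
        exact LinearMap.mem_range_self _ _
      · rintro _ ⟨u, rfl⟩
        have e1 := act_act_of_qcomm (zElt_pow_mul_X₄ h m) u
        refine (Submodule.smul_mem_iff _ (pow_ne_zero m (inv_ne_zero hs2))).1 ?_
        rw [← e1]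
        exact LinearMap.mem_range_self _ _
    obtain ⟨u, hu⟩ := (LinearMap.range_eq_top.1 htop).iterate l v₃
    rw [← Module.End.pow_apply, ← act_pow, ← pow_mul, mul_comm, pow_mul, act_pow,
      show act N (zElt r s ^ l) = 0 from
        LinearMap.ext fun w => by rw [hζ, hζ0, zero_smul]; rfl, zero_pow hm.ne'] at hu
    exact hv₃ hu.symm
  · have hm := m₃_pos h 1
    have hqm := hqs _ (q_pow_m₃ r s 1)
    have hsm : (((s ^ 2) ^ m₃ r s 1)⁻¹) ^ ell₃ r s = 1 := by
      have := s_pow_m₃ h 1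
      rw [mul_one] at this
      rw [inv_pow, ← pow_mul, ← pow_mul,
        show 2 * (m₃ r s 1 * ell₃ r s) = 2 * ell₃ r s * m₃ r s 1 by ring, this, inv_one]
    have hm3 : ∀ μ : ℂ, μ ≠ 0 → m₃ r s μ = m₃ r s 1 := fun μ hμ => by simp [m₃, hμ]
    set m := m₃ r s 1
    have hTz : ∀ w, (act N (zElt r s ^ m) ^ l) w = ζ ^ m • w := fun w => by
      rw [← act_pow, ← pow_mul, mul_comm, pow_mul, act_pow]
      exact pow_apply_of_eigenvector (hζ w) _
    obtain ⟨v, ⟨⟨h1, h3⟩, h2⟩, hv, μ, hz⟩ := exists_eigenvector_of_pow (act N (zElt r s ^ m))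
      (LinearMap.ker (act N (X₁ r s)) ⊓ Module.End.eigenspace (act N (X₃ r s)) c
        ⊓ Module.End.eigenspace (act N (X₂ r s ^ ell₃ r s)) η)
      (fun w hw => ⟨⟨act_eq_zero_of_qcomm (pow_ne_zero _ (mul_ne_zero hr2 hs2))
          (X₁_mul_zElt_pow h hm hqm) hw.1.1,
        Module.End.mem_eigenspace_iff.2 (act_eigenvector_of_commute
          (Commute.pow_right (X₃_mul_zElt h) m) (Module.End.mem_eigenspace_iff.1 hw.1.2))⟩,
        Module.End.mem_eigenspace_iff.2 (act_eigenvector_of_commute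
          (commute_pow_of_qcomm (zElt_pow_mul_X₂ h m) hsm).symm
          (Module.End.mem_eigenspace_iff.1 hw.2))⟩)
      hl ⟨⟨h31, h33⟩, Module.End.mem_eigenspace_iff.2 h32⟩ hv₃ (hTz v₃)
    have hμ : μ ≠ 0 := by
      rintro rfl
      have e1 := hTz v
      rw [pow_apply_of_eigenvector hz, zero_pow hl.ne', zero_smul] at e1
      exact smul_ne_zero (pow_ne_zero _ hζ0) hv e1.symm
    refine ⟨Units.mk0 ν hν0, Units.mk0 c hc, μ, nonempty_equiv_MNu h hl hl₁ hl₂ _ _ _ hv h1 ?_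
      (Module.End.mem_eigenspace_iff.1 h3) ?_⟩
    · rw [← act_pow, Module.End.mem_eigenspace_iff.1 h2, Units.val_mk0, hν]
    · rw [hm3 μ hμ, ← act_pow, hz]

end Nu

end UB2

theorem mainTheorem5 (r s : ℂ) (h : UB2.Params r s)
    (l : ℕ) (hl : 0 < l) (hl₁ : (r * s) ^ l = 1) (hl₂ : (r * s⁻¹) ^ l = 1)
    (N : Type*) [AddCommGroup N] [Module ℂ N] [Module (UB2.UPlus r s)ᵐᵒᵖ N]
    [IsScalarTower ℂ (UB2.UPlus r s)ᵐᵒᵖ N] [IsSimpleModule (UB2.UPlus r s)ᵐᵒᵖ N]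
    (hX₁ : ∃ k : ℕ, ∀ v : N, MulOpposite.op (UB2.X₁ r s ^ k) • v = 0)
    (hX₃ : Function.Bijective fun v : N => MulOpposite.op (UB2.X₃ r s) • v) :
    UB2.X₂ r s ^ l ∈ Subalgebra.center ℂ (UB2.UPlus r s) ∧
    ∃ β : ℂ, (∀ v : N, MulOpposite.op (UB2.X₂ r s ^ l) • v = β • v) ∧
      (β ≠ 0 → ∃ (ν₁ ν₂ : ℂˣ) (ν₃ : ℂ),
        Nonempty (N ≃ₗ[(UB2.UPlus r s)ᵐᵒᵖ] UB2.MNu h ν₁ ν₂ ν₃)) ∧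
      (β = 0 → ∃ (ξ₁ : ℂˣ) (ξ₂ : ℂ),
        Nonempty (N ≃ₗ[(UB2.UPlus r s)ᵐᵒᵖ] UB2.MXi h ξ₁ ξ₂)) := by
  have hc := UB2.X₂_pow_mem_center h hl hl₁ hl₂
  obtain ⟨β, hβ⟩ := UB2.exists_act_eq_smul_of_mem_center (N := N) hc
  obtain ⟨k, hk⟩ := hX₁
  have hk' : UB2.act N (UB2.X₁ r s) ^ k = 0 := by
    rw [← UB2.act_pow]
    exact LinearMap.ext hk
  refine ⟨hc, β, hβ, fun hβ0 => ?_, fun hβ0 => ?_⟩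
  · refine UB2.exists_equiv_MNu h hl hl₁ hl₂ ⟨k, hk'⟩ hβ0 (fun v => ?_) hX₃.1
    rw [← UB2.act_pow]
    exact hβ v
  · refine UB2.exists_equiv_MXi h ⟨k, hk'⟩ ⟨l, ?_⟩ hX₃.1
    rw [← UB2.act_pow]
    exact LinearMap.ext fun v => by rw [hβ, hβ0, zero_smul]; rfl
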